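/- Let $(\mathcal A,\tau)$ be a tracial $C^*$-probability space, i.e. $\mathcal A$ is a unital $C^*$-algebra and $\tau$ is a faithful tracial state on it. Let $s\in\mathcal A$ be semicircular: $s$ is self-adjoint and, for some $\sigma>0$, $\tau(s^{2k})=\sigma^{2k}C_k$ ($C_k$ the $k$-th Catalan number) and $\tau(s^{2k+1})=0$ for all $k\ge 0$. Let $x\in\mathcal A$ be free from $s$, meaning that the unital subalgebras generated by $s$ and by $x$ are free. Write $[s,x]=sx-xs$, let $\kappa_n(a_1,\dots,a_n)$ be the free cumulants, defined by $\tau(a_1\cdots a_n)=\sum_{\pi\in NC(n)}\prod_{V\in\pi}\kappa_{|V|}(a|_V)$, where $NC(n)$ is the set of non-crossing partitions of $\{1,\dots,n\}$ and $a|_V$ is the tuple of the $a_i$, $i\in V$, in increasing order of $i$, and put $\kappa_n(a)=\kappa_n(a,\dots,a)$. Then the following hold. 1. $\kappa_n(s+i[s,x])=\kappa_n(s)+\kappa_n(i[s,x])$ for all $n\ge1$. Equivalently, the distribution of $s+i[s,x]$ is the free additive convolution of those of $s$ and $i[s,x]$: whenever $a,b$ are free elements of a unital complex algebra $\mathcal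 B$ with a unital linear functional $\varphi$ such that $\varphi(a^n)=\tau(s^n)$ and $\varphi(b^n)=\tau((i[s,x])^n)$ for all $n$, then $\varphi((a+b)^n)=\tau((s+i[s,x])^n)$ for all $n$. 2. If $x$ is self-adjoint, then $s$, $i[s,x]$ and $s+i[s,x]$ are self-adjoint, their distributions are compactly supported probability measures $\mu_s$, $\mu_{i[s,x]}$, $\mu_{s+i[s,x]}$ on $\mathbb R$ (the moments of the measure being those of the element), and $\mu_{s+i[s,x]}=\mu_s\boxplus\mu_{i[s,x]}$, where $\mu\boxplus\nu$ is the compactly supported probability measure with $\kappa_n(\mu\boxplus\nu)=\kappa_n(\mu)+\kappa_n(\nu)$ for all $n\ge1$. 3. $\kappa_4(s,i[s,x],i[s,x],s)=\kappa_2(s)^2\,\kappa_2(x)$. If $\kappa_2(x)\neq0$, this mixed cumulant is non-zero and $s$ and $i[s,x]$ are not free. The condition $\kappa_2(x)\ne0$ holds whenever $x$ is self-adjoint and not a scalar multiple of $1$. -/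

import Mathlib

universe u v

open MeasureTheory

namespace FreeProb

/-- A partition of `{0, …, n-1}` is non-crossing if there are no `i < j < k < l` with `i, k` in one
block and `j, l` in a different block. -/
def IsNoncrossing {n : ℕ} (π : Finpartition (Finset.univ : Finset (Fin n))) : Prop :=
  ∀ V ∈ π.parts, ∀ W ∈ π.parts, ∀ i ∈ V, ∀ j ∈ W, ∀ k ∈ V, ∀ l ∈ W,
    i < j → j < k → k < l → V = W

open Classical in
/-- The finite set `NC(n)` of non-crossing partitions of `{0, …, n-1}`. -/
noncomputable def NC (n : ℕ) : Finset (Finpartition (Finset.univ : Finset (Fin n))) :=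
  Finset.univ.filter IsNoncrossing

/-- The subtuple of `(a_0, …, a_{n-1})` indexed by `V`, in increasing order of the indices. -/
def restrict {α : Type*} {n : ℕ} (a : Fin n → α) (V : Finset (Fin n)) : Fin V.card → α :=
  fun i => a (V.orderEmbOfFin rfl i)

open Classical in
/-- The free cumulants of a family `M` of joint moments, defined recursively by the moment-cumulant
formula `M_n(a) = ∑_{π ∈ NC(n)} ∏_{V ∈ π} κ_{|V|}(a|_V)`: one solves for the term `κ_n(a)`, which
comes from the partition with the single block `{0, …, n-1}`. In every other partition all blocks
have fewer than `n` elements, so the `else` branch is never used there. -/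
noncomputable def cumulant {α R : Type*} [CommRing R] (M : (n : ℕ) → (Fin n → α) → R) :
    (n : ℕ) → (Fin n → α) → R
  | n, a => M n a - ∑ π ∈ (NC n).filter (fun π => Finset.univ ∉ π.parts), ∏ V ∈ π.parts,
      if _h : V.card < n then cumulant M V.card (restrict a V) else 0
termination_by n => n

theorem cumulant_univ {α R : Type*} [CommRing R] (M : (n : ℕ) → (Fin n → α) → R)
    (n : ℕ) (a : Fin n → α) :
    cumulant M (Finset.univ : Finset (Fin n)).card (restrict a Finset.univ) = cumulant M n a := by
  have key : ∀ (m : ℕ) (h : m = n) (b : Fin m → α), (∀ i, b i = a (Fin.cast h i)) →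
      cumulant M m b = cumulant M n a := by
    rintro m rfl b hb
    congr 1
    funext i
    simpa using hb i
  refine key _ (by simp) _ fun i => ?_
  unfold restrict
  congr 1
  have h : (Finset.univ : Finset (Fin n)).card = n := by simp
  have := Finset.orderEmbOfFin_unique (s := (Finset.univ : Finset (Fin n))) rfl
    (f := fun i => Fin.cast h i) (fun _ => Finset.mem_univ _) (fun i j hij => (by exact hij : i.val < j.val))
  exact (congrFun this i).symm

/-- The moment-cumulant formula. -/
theorem moment_eq_sum_cumulant {α R : Type*} [CommRing R] (M : (n : ℕ) → (Fin n → α) → R)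
    (n : ℕ) (hn : 1 ≤ n) (a : Fin n → α) :
    M n a = ∑ π ∈ NC n, ∏ V ∈ π.parts, cumulant M V.card (restrict a V) := by
  classical
  have hne : (Finset.univ : Finset (Fin n)) ≠ ⊥ := by
    have : Nonempty (Fin n) := ⟨⟨0, hn⟩⟩
    simpa using Finset.univ_nonempty.ne_empty
  have hone : (NC n).filter (fun π => Finset.univ ∈ π.parts) = {Finpartition.indiscrete hne} := by
    ext π
    simp only [NC, Finset.mem_filter, Finset.mem_univ, true_and, Finset.mem_singleton]
    constructor
    · rintro ⟨-, h⟩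
      ext V
      simp only [Finpartition.indiscrete_parts, Finset.mem_singleton]
      constructor
      · intro hV
        obtain ⟨i, hi⟩ := π.nonempty_of_mem_parts hV
        exact π.eq_of_mem_parts hV h hi (Finset.mem_univ i)
      · rintro rfl
        exact h
    · rintro rfl
      refine ⟨?_, by simp⟩
      intro V hV W hW
      simp only [Finpartition.indiscrete_parts, Finset.mem_singleton] at hV hW
      intros
      rw [hV, hW]
  rw [← Finset.sum_filter_add_sum_filter_not _ (fun π => Finset.univ ∈ π.parts), hone]
  simp only [Finset.sum_singleton, Finpartition.indiscrete_parts, Finset.prod_singleton]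
  rw [cumulant_univ, cumulant.eq_1 M n a]
  have : ∑ π ∈ (NC n).filter (fun π => Finset.univ ∉ π.parts), (∏ V ∈ π.parts,
      if _h : V.card < n then cumulant M V.card (restrict a V) else 0) =
      ∑ π ∈ (NC n).filter (fun π => Finset.univ ∉ π.parts), ∏ V ∈ π.parts,
        cumulant M V.card (restrict a V) := by
    refine Finset.sum_congr rfl fun π hπ => Finset.prod_congr rfl fun V hV => ?_
    rw [dif_pos]
    have hV' : V ≠ Finset.univ := by
      rintro rfl
      exact (Finset.mem_filter.mp hπ).2 hV
    simpa using Finset.card_lt_card (Finset.ssubset_univ_iff.mpr hV')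
  rw [this]
  ring

section Algebraic

variable {A : Type*} [Ring A] [Algebra ℂ A]

/-- The free cumulant `κ_n(a_0, …, a_{n-1})` with respect to a linear functional `φ`. -/
noncomputable def freeCumulant (φ : A →ₗ[ℂ] ℂ) {n : ℕ} (a : Fin n → A) : ℂ :=
  cumulant (fun m b => φ (List.ofFn (n := m) b).prod) n a

/-- The free cumulant `κ_n(a) = κ_n(a, …, a)` of a single element. -/
noncomputable def freeCumulant₁ (φ : A →ₗ[ℂ] ℂ) (n : ℕ) (a : A) : ℂ :=
  freeCumulant φ (fun _ : Fin n => a)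

/-- Free independence of a family of unital subalgebras: `φ(y_1 ⋯ y_n) = 0` for `n ≥ 1` whenever
all `y_k` are centered and consecutive factors come from different subalgebras. -/
def FreeSubalgebras {ι : Type*} (φ : A →ₗ[ℂ] ℂ) (S : ι → Subalgebra ℂ A) : Prop :=
  ∀ l : List (ι × A), l ≠ [] → (∀ p ∈ l, p.2 ∈ S p.1 ∧ φ p.2 = 0) →
    l.IsChain (fun p q => p.1 ≠ q.1) → φ (l.map Prod.snd).prod = 0

/-- Two elements are free if the unital subalgebras they generate are. -/
def Free (φ : A →ₗ[ℂ] ℂ) (a b : A) : Prop :=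
  FreeSubalgebras φ (fun t : Bool => Algebra.adjoin ℂ {if t then a else b})

end Algebraic

section CStar

variable {A : Type*} [CStarAlgebra A]

open scoped ComplexOrder in
/-- `τ` is a faithful tracial state, so that `(A, τ)` is a tracial C*-probability space. -/
structure IsFaithfulTracialState (τ : A →ₗ[ℂ] ℂ) : Prop where
  map_one : τ 1 = 1
  nonneg : ∀ a : A, 0 ≤ τ (star a * a)
  faithful : ∀ a : A, τ (star a * a) = 0 → a = 0
  tracial : ∀ a b : A, τ (a * b) = τ (b * a)

/-- A (centered, non-degenerate) semicircular element: self-adjoint, with the moments of the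
semicircle law of variance `σ²` for some `σ > 0`. -/
def IsSemicircular (τ : A →ₗ[ℂ] ℂ) (s : A) : Prop :=
  IsSelfAdjoint s ∧ ∃ σ : ℝ, 0 < σ ∧ ∀ k : ℕ,
    τ (s ^ (2 * k)) = (σ : ℂ) ^ (2 * k) * (catalan k : ℂ) ∧ τ (s ^ (2 * k + 1)) = 0

/-- A compactly supported Borel probability measure on `ℝ`. -/
def IsCompactProb (μ : Measure ℝ) : Prop :=
  IsProbabilityMeasure μ ∧ ∃ K : Set ℝ, IsCompact K ∧ μ Kᶜ = 0

/-- `μ` is the distribution of the self-adjoint element `a`: the (unique) compactly supported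
probability measure on `ℝ` whose moments are those of `a`. -/
def IsDistribution (τ : A →ₗ[ℂ] ℂ) (a : A) (μ : Measure ℝ) : Prop :=
  IsSelfAdjoint a ∧ IsCompactProb μ ∧ ∀ n : ℕ, τ (a ^ n) = ((∫ t, t ^ n ∂μ : ℝ) : ℂ)

end CStar

/-- The `n`-th free cumulant of a (compactly supported) measure on `ℝ`. -/
noncomputable def measureCumulant (μ : Measure ℝ) (n : ℕ) : ℝ :=
  cumulant (fun m (_ : Fin m → Unit) => ∫ t, t ^ m ∂μ) n (fun _ => ())

/-- `ρ = μ ⊞ ν` for compactly supported probability measures on `ℝ`: `ρ` is the (unique) compactly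
supported probability measure whose free cumulants (the coefficients of its R-transform) are the
sums of those of `μ` and `ν`. -/
def IsFreeConvolution (μ ν ρ : Measure ℝ) : Prop :=
  IsCompactProb μ ∧ IsCompactProb ν ∧ IsCompactProb ρ ∧
    ∀ n : ℕ, 1 ≤ n → measureCumulant ρ n = measureCumulant μ n + measureCumulant ν n

end FreeProb

/-!
The proof follows the moments `m_n(t) = τ((t s + y)^n)` with `y = i[s, x]`. Put `c = i x`, so that
`t s + y = s (t + c) - c s`. Its free difference quotient with respect to `s` is
`1 ⊗ (t + c) - c ⊗ 1`, and the Schwinger-Dyson equation `τ(s p) = σ² (τ ⊗ τ)(∂p)`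
(`schwinger_dyson`) gives
`m_n' = n τ(s (t s + y)^(n-1)) = σ² t n ∑_{j+k=n-2} m_j m_k`,
because the contributions of `c` cancel by traciality (`satisfiesBurgers_of_free`). The commutator
thus drops out: this is the same complex Burgers equation that governs `t a + b` for a semicircular
`a` free from `b`, and its solution is determined by the values at `t = 0`
(`SatisfiesBurgers.unique`). Comparison with a free pair `a`, `b` gives the statement about free
copies. For this `φ` has to be tracial on the algebra generated by `a` and `b`, which freeness
implies (`Free.map_mul_comm`).

On the side of cumulants, adding `σ² t²` to `κ₂` also solves the Burgers equation
(`satisfiesBurgers_momentOf`): the derivative marks a two-element block `{i, j}` of a non-crossing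
partition, and removing that block leaves independent non-crossing partitions of the points inside
and outside (`sum_prod_erase_pair`). Hence `s + y` has the cumulants of `y` except for `σ²` added
to `κ₂`, which is the asserted additivity.

The distributions come from the Riesz-Markov-Kakutani theorem on the spectrum. The mixed cumulant
equals `τ(s² y²) - τ(s²) τ(y²)` since all other partitions of four points contribute zero. This
difference vanishes if `s` and `y` are free, and is evaluated by the freeness of `s` and
`x - τ(x)`.
-/

namespace FreeProb

/-! ### Non-crossing partitions -/

section Noncrossing

variable {α β : Type*} [LinearOrder α] [LinearOrder β]

/-- `P` is the set of blocks of a non-crossing partition of the finite set `S`. -/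
structure IsNCPartition (S : Finset α) (P : Finset (Finset α)) : Prop where
  subset : ∀ V ∈ P, V ⊆ S
  nonempty : ∀ V ∈ P, V.Nonempty
  cover : ∀ x ∈ S, ∃ V ∈ P, x ∈ V
  eq_of_mem : ∀ V ∈ P, ∀ W ∈ P, ∀ x, x ∈ V → x ∈ W → V = W
  noncrossing : ∀ V ∈ P, ∀ W ∈ P, ∀ i ∈ V, ∀ j ∈ W, ∀ k ∈ V, ∀ l ∈ W,
    i < j → j < k → k < l → V = W

open Classical in
/-- The non-crossing partitions of a finite subset `S` of a linear order, as sets of blocks. Unlike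
`NC n`, this allows to restrict a partition to a subset without renumbering. -/
noncomputable def ncPartitions (S : Finset α) : Finset (Finset (Finset α)) :=
  S.powerset.powerset.filter (IsNCPartition S)

theorem mem_ncPartitions {S : Finset α} {P : Finset (Finset α)} :
    P ∈ ncPartitions S ↔ IsNCPartition S P := by
  classical
  simp only [ncPartitions, Finset.mem_filter, Finset.mem_powerset, and_iff_right_iff_imp]
  intro h V hV
  exact Finset.mem_powerset.mpr (h.subset V hV)

/-- The right-hand side of the moment-cumulant formula for a single variable with cumulants `κ`,
with the points of `S` as positions. -/
noncomputable def ncSum (κ : ℕ → ℂ) (S : Finset α) : ℂ :=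
  ∑ P ∈ ncPartitions S, ∏ V ∈ P, κ V.card

/-- The moments of a variable with cumulants `κ`. -/
noncomputable def momentOf (κ : ℕ → ℂ) (n : ℕ) : ℂ :=
  ncSum κ (Finset.univ : Finset (Fin n))

theorem momentOf_eq_sum_NC (κ : ℕ → ℂ) (n : ℕ) :
    momentOf κ n = ∑ π ∈ NC n, ∏ V ∈ π.parts, κ V.card := by
  classical
  rw [momentOf, ncSum]
  symm
  refine Finset.sum_bij (fun π _ => π.parts) ?_ ?_ ?_ ?_
  · intro π hπ
    rw [mem_ncPartitions]
    have h := (Finset.mem_filter.mp hπ).2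
    refine ⟨fun V _ => Finset.subset_univ V, fun V hV => π.nonempty_of_mem_parts hV,
      fun x _ => ?_, fun V hV W hW x hx hx' => π.eq_of_mem_parts hV hW hx hx', h⟩
    simpa using π.exists_mem (Finset.mem_univ x)
  · intro π _ π' _ h
    exact Finpartition.ext h
  · intro P hP
    rw [mem_ncPartitions] at hP
    refine ⟨Finpartition.ofExistsUnique P (fun V _ => Finset.subset_univ V) ?_ ?_, ?_, rfl⟩
    · intro x hx
      obtain ⟨V, hV, hxV⟩ := hP.cover x hx
      exact ⟨V, ⟨hV, hxV⟩, fun W hW => hP.eq_of_mem W hW.1 V hV x hW.2 hxV⟩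
    · intro h
      simpa using hP.nonempty ∅ h
    · simp only [NC, Finset.mem_filter, Finset.mem_univ, true_and]
      exact hP.noncrossing
  · intro π _
    rfl

theorem ncSum_map (κ : ℕ → ℂ) (S : Finset α) (f : α ↪o β) :
    ncSum κ (S.map f.toEmbedding) = ncSum κ S := by
  classical
  symm
  refine Finset.sum_bij (fun P _ => P.map (Finset.mapEmbedding f.toEmbedding).toEmbedding)
    ?_ ?_ ?_ ?_
  · intro P hP
    rw [mem_ncPartitions] at hP ⊢
    constructor
    · intro V hV
      simp only [Finset.mem_map] at hV
      obtain ⟨U, hU, rfl⟩ := hV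
      exact Finset.map_subset_map.mpr (hP.subset U hU)
    · intro V hV
      simp only [Finset.mem_map] at hV
      obtain ⟨U, hU, rfl⟩ := hV
      exact Finset.map_nonempty.mpr (hP.nonempty U hU)
    · intro x hx
      obtain ⟨y, hy, rfl⟩ := Finset.mem_map.mp hx
      obtain ⟨V, hV, hyV⟩ := hP.cover y hy
      exact ⟨_, Finset.mem_map_of_mem _ hV, Finset.mem_map_of_mem _ hyV⟩
    · intro V hV W hW x hxV hxW
      simp only [Finset.mem_map] at hV hW
      obtain ⟨V, hV, rfl⟩ := hV
      obtain ⟨W, hW, rfl⟩ := hW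
      obtain ⟨y, hy, rfl⟩ := Finset.mem_map.mp hxV
      obtain ⟨z, hz, hzy⟩ := Finset.mem_map.mp hxW
      obtain rfl := f.toEmbedding.injective hzy
      rw [hP.eq_of_mem V hV W hW _ hy hz]
    · intro V hV W hW i hi j hj k hk l hl hij hjk hkl
      simp only [Finset.mem_map] at hV hW
      obtain ⟨V, hV, rfl⟩ := hV
      obtain ⟨W, hW, rfl⟩ := hW
      obtain ⟨i, hi', rfl⟩ := Finset.mem_map.mp hi
      obtain ⟨j, hj', rfl⟩ := Finset.mem_map.mp hj
      obtain ⟨k, hk', rfl⟩ := Finset.mem_map.mp hk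
      obtain ⟨l, hl', rfl⟩ := Finset.mem_map.mp hl
      have := hP.noncrossing V hV W hW i hi' j hj' k hk' l hl' (f.lt_iff_lt.mp hij)
        (f.lt_iff_lt.mp hjk) (f.lt_iff_lt.mp hkl)
      rw [this]
  · intro P _ Q _ h
    exact Finset.map_injective _ h
  · intro Q hQ
    rw [mem_ncPartitions] at hQ
    have hmem : ∀ V ∈ Q, ∃ U, U ⊆ S ∧ U.map f.toEmbedding = V := fun V hV => by
      obtain ⟨U, hU, h⟩ := Finset.subset_map_iff.mp (hQ.subset V hV)
      exact ⟨U, hU, h.symm⟩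
    refine ⟨S.powerset.filter (fun U => U.map f.toEmbedding ∈ Q), ?_, ?_⟩
    · rw [mem_ncPartitions]
      constructor
      · intro V hV
        exact Finset.mem_powerset.mp (Finset.mem_filter.mp hV).1
      · intro V hV
        exact Finset.map_nonempty.mp (hQ.nonempty _ (Finset.mem_filter.mp hV).2)
      · intro x hx
        obtain ⟨V, hV, hxV⟩ := hQ.cover (f x) (Finset.mem_map_of_mem f.toEmbedding hx)
        obtain ⟨U, hU, rfl⟩ := hmem V hV
        exact ⟨U, Finset.mem_filter.mpr ⟨Finset.mem_powerset.mpr hU, hV⟩,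
          (Finset.mem_map' f.toEmbedding).mp hxV⟩
      · intro V hV W hW x hxV hxW
        exact Finset.map_injective f.toEmbedding (hQ.eq_of_mem _ (Finset.mem_filter.mp hV).2 _
          (Finset.mem_filter.mp hW).2 _ (Finset.mem_map_of_mem _ hxV)
          (Finset.mem_map_of_mem _ hxW))
      · intro V hV W hW i hi j hj k hk l hl hij hjk hkl
        exact Finset.map_injective f.toEmbedding (hQ.noncrossing _ (Finset.mem_filter.mp hV).2 _
          (Finset.mem_filter.mp hW).2 _ (Finset.mem_map_of_mem _ hi) _
          (Finset.mem_map_of_mem _ hj) _ (Finset.mem_map_of_mem _ hk) _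
          (Finset.mem_map_of_mem _ hl) (f.lt_iff_lt.mpr hij) (f.lt_iff_lt.mpr hjk)
          (f.lt_iff_lt.mpr hkl))
    · ext V
      simp only [Finset.mem_map, Finset.mem_filter, Finset.mem_powerset]
      constructor
      · rintro ⟨U, ⟨_, hU⟩, rfl⟩
        exact hU
      · intro hV
        obtain ⟨U, hU, rfl⟩ := hmem V hV
        exact ⟨U, ⟨hU, hV⟩, rfl⟩
  · intro P _
    rw [Finset.prod_map]
    refine Finset.prod_congr rfl fun V _ => ?_
    exact congrArg κ (Finset.card_map _).symm

theorem ncSum_eq_momentOf (κ : ℕ → ℂ) (S : Finset α) : ncSum κ S = momentOf κ S.card := by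
  rw [momentOf, ← ncSum_map κ Finset.univ (S.orderEmbOfFin rfl), Finset.map_orderEmbOfFin_univ]

/-- Removing a block `{i, j}` from a non-crossing partition leaves independent non-crossing
partitions of the points between `i` and `j` and of the points outside. -/
theorem sum_prod_erase_pair (κ : ℕ → ℂ) (S : Finset α) {i j : α} (hi : i ∈ S) (hj : j ∈ S)
    (hij : i < j) :
    ∑ P ∈ (ncPartitions S).filter (fun P => {i, j} ∈ P), ∏ V ∈ P.erase {i, j}, κ V.card =
      ncSum κ (S.filter fun k => i < k ∧ k < j) * ncSum κ (S.filter fun k => k < i ∨ j < k) := by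
  classical
  rw [ncSum, ncSum, Finset.sum_mul_sum, ← Finset.sum_product']
  set I := S.filter fun k => i < k ∧ k < j with hI
  set O := S.filter fun k => k < i ∨ j < k with hO
  have mI : ∀ k, k ∈ I ↔ k ∈ S ∧ i < k ∧ k < j := fun k => by simp [hI]
  have mO : ∀ k, k ∈ O ↔ k ∈ S ∧ (k < i ∨ j < k) := fun k => by simp [hO]
  clear_value I O
  -- a block other than `{i, j}` lies on one side
  have side : ∀ P, IsNCPartition S P → {i, j} ∈ P → ∀ V ∈ P, V ≠ {i, j} → V ⊆ I ∨ V ⊆ O := by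
    intro P hP hp V hV hne
    have hk : ∀ k ∈ V, k ∈ I ∨ k ∈ O := by
      intro k hk
      have h1 : k ≠ i := by
        rintro rfl
        exact hne (hP.eq_of_mem _ hV _ hp _ hk (by simp))
      have h2 : k ≠ j := by
        rintro rfl
        exact hne (hP.eq_of_mem _ hV _ hp _ hk (by simp))
      have h3 := hP.subset _ hV hk
      rw [mI, mO]
      grind
    by_contra! hcon
    obtain ⟨h1, h2⟩ := hcon
    obtain ⟨k, hkV, hkI⟩ := Finset.not_subset.mp h1
    obtain ⟨l, hlV, hlO⟩ := Finset.not_subset.mp h2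
    have hkO := (hk k hkV).resolve_left hkI
    have hlI := (hk l hlV).resolve_right hlO
    rw [mO] at hkO
    rw [mI] at hlI
    rcases hkO.2 with h | h
    · exact hne (hP.noncrossing V hV _ hp k hkV i (by simp) l hlV j (by simp) h hlI.2.1 hlI.2.2)
    · exact hne (hP.noncrossing _ hp V hV i (by simp) l hlV j (by simp) k hkV hlI.2.1 hlI.2.2
        h).symm
  have disj : ∀ V : Finset α, V.Nonempty → V ⊆ I → ¬ V ⊆ O := by
    rintro V ⟨k, hk⟩ h1 h2
    have h1 := (mI k).mp (h1 hk)
    have h2 := (mO k).mp (h2 hk)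
    grind
  have hpI : ¬ ({i, j} : Finset α) ⊆ I := fun h => by
    have := (mI i).mp (h (by simp))
    simp at this
  have hpO : ¬ ({i, j} : Finset α) ⊆ O := fun h => by
    have := (mO i).mp (h (by simp))
    have := hij.not_gt
    simp_all
  refine Finset.sum_bij' (fun P _ => (P.filter (· ⊆ I), P.filter (· ⊆ O)))
    (fun Q _ => insert {i, j} (Q.1 ∪ Q.2)) ?_ ?_ ?_ ?_ ?_
  · intro P hP
    rw [Finset.mem_filter, mem_ncPartitions] at hP
    obtain ⟨hP, hp⟩ := hP
    rw [Finset.mem_product, mem_ncPartitions, mem_ncPartitions]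
    have part : ∀ T : Finset α, T ⊆ S → (∀ V ∈ P, ∀ x ∈ V, x ∈ T → V ⊆ T) →
        IsNCPartition T (P.filter (· ⊆ T)) := by
      intro T hT h
      refine ⟨fun V hV => (Finset.mem_filter.mp hV).2,
        fun V hV => hP.nonempty V (Finset.mem_filter.mp hV).1, fun x hx => ?_,
        fun V hV W hW => hP.eq_of_mem V (Finset.mem_filter.mp hV).1 W (Finset.mem_filter.mp hW).1,
        fun V hV W hW =>
          hP.noncrossing V (Finset.mem_filter.mp hV).1 W (Finset.mem_filter.mp hW).1⟩
      obtain ⟨V, hV, hxV⟩ := hP.cover x (hT hx)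
      exact ⟨V, Finset.mem_filter.mpr ⟨hV, h V hV x hxV hx⟩, hxV⟩
    constructor
    · refine part I (fun x hx => ((mI x).mp hx).1) fun V hV x hxV hxI => ?_
      have hne : V ≠ {i, j} := by
        rintro rfl
        have := (mI x).mp hxI
        simp at hxV
        grind
      refine (side P hP hp V hV hne).resolve_right fun h => ?_
      have h1 := (mI x).mp hxI
      have h2 := (mO x).mp (h hxV)
      grind
    · refine part O (fun x hx => ((mO x).mp hx).1) fun V hV x hxV hxO => ?_
      have hne : V ≠ {i, j} := by
        rintro rfl
        have := (mO x).mp hxO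
        simp at hxV
        grind
      refine (side P hP hp V hV hne).resolve_left fun h => ?_
      have h1 := (mI x).mp (h hxV)
      have h2 := (mO x).mp hxO
      grind
  · rintro ⟨Q₁, Q₂⟩ hQ
    rw [Finset.mem_product, mem_ncPartitions, mem_ncPartitions] at hQ
    obtain ⟨h₁, h₂⟩ := hQ
    simp only at h₁ h₂
    have e1 : ∀ V ∈ Q₁, ∀ x ∈ V, x ∈ S ∧ i < x ∧ x < j := fun V hV x hx =>
      (mI x).mp (h₁.subset V hV hx)
    have e2 : ∀ V ∈ Q₂, ∀ x ∈ V, x ∈ S ∧ (x < i ∨ j < x) := fun V hV x hx =>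
      (mO x).mp (h₂.subset V hV hx)
    rw [Finset.mem_filter, mem_ncPartitions]
    refine ⟨?_, by simp⟩
    constructor
    · intro V hV x hx
      simp only [Finset.mem_insert, Finset.mem_union] at hV
      rcases hV with rfl | hV | hV
      · simp only [Finset.mem_insert, Finset.mem_singleton] at hx
        rcases hx with rfl | rfl <;> assumption
      · exact (e1 V hV x hx).1
      · exact (e2 V hV x hx).1
    · intro V hV
      simp only [Finset.mem_insert, Finset.mem_union] at hV
      rcases hV with rfl | hV | hV
      · simp
      · exact h₁.nonempty V hV
      · exact h₂.nonempty V hV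
    · intro x hx
      have : x = i ∨ x = j ∨ x ∈ I ∨ x ∈ O := by
        rw [mI, mO]
        grind
      rcases this with rfl | rfl | h | h
      · exact ⟨{x, j}, by simp, by simp⟩
      · exact ⟨{i, x}, by simp, by simp⟩
      · obtain ⟨V, hV, hx⟩ := h₁.cover x h
        exact ⟨V, by simp [hV], hx⟩
      · obtain ⟨V, hV, hx⟩ := h₂.cover x h
        exact ⟨V, by simp [hV], hx⟩
    · intro V hV W hW x hxV hxW
      simp only [Finset.mem_insert, Finset.mem_union] at hV hW
      rcases hV with rfl | hV | hV <;> rcases hW with rfl | hW | hW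
      · rfl
      · have := e1 W hW x hxW
        simp only [Finset.mem_insert, Finset.mem_singleton] at hxV
        grind
      · have := e2 W hW x hxW
        simp only [Finset.mem_insert, Finset.mem_singleton] at hxV
        grind
      · have := e1 V hV x hxV
        simp only [Finset.mem_insert, Finset.mem_singleton] at hxW
        grind
      · exact h₁.eq_of_mem V hV W hW x hxV hxW
      · have := e1 V hV x hxV
        have := e2 W hW x hxW
        grind
      · have := e2 V hV x hxV
        simp only [Finset.mem_insert, Finset.mem_singleton] at hxW
        grind
      · have := e2 V hV x hxV
        have := e1 W hW x hxW
        grind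
      · exact h₂.eq_of_mem V hV W hW x hxV hxW
    · intro V hV W hW p hp q hq r hr s hs hpq hqr hrs
      simp only [Finset.mem_insert, Finset.mem_union] at hV hW
      rcases hV with rfl | hV | hV <;> rcases hW with rfl | hW | hW
      · rfl
      · have := e1 W hW q hq
        have := e1 W hW s hs
        simp only [Finset.mem_insert, Finset.mem_singleton] at hp hr
        grind
      · have := e2 W hW q hq
        have := e2 W hW s hs
        simp only [Finset.mem_insert, Finset.mem_singleton] at hp hr
        grind
      · have := e1 V hV p hp
        have := e1 V hV r hr
        simp only [Finset.mem_insert, Finset.mem_singleton] at hq hs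
        grind
      · exact h₁.noncrossing V hV W hW p hp q hq r hr s hs hpq hqr hrs
      · have := e1 V hV p hp
        have := e1 V hV r hr
        have := e2 W hW q hq
        grind
      · have := e2 V hV p hp
        have := e2 V hV r hr
        simp only [Finset.mem_insert, Finset.mem_singleton] at hq hs
        grind
      · have := e1 W hW q hq
        have := e1 W hW s hs
        have := e2 V hV r hr
        grind
      · exact h₂.noncrossing V hV W hW p hp q hq r hr s hs hpq hqr hrs
  · intro P hP
    rw [Finset.mem_filter, mem_ncPartitions] at hP
    obtain ⟨hP, hp⟩ := hP
    ext V
    simp only [Finset.mem_insert, Finset.mem_union, Finset.mem_filter]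
    constructor
    · rintro (rfl | h | h)
      exacts [hp, h.1, h.1]
    · intro hV
      by_cases hne : V = {i, j}
      · exact Or.inl hne
      · exact Or.inr ((side P hP hp V hV hne).imp (fun h => ⟨hV, h⟩) fun h => ⟨hV, h⟩)
  · rintro ⟨Q₁, Q₂⟩ hQ
    rw [Finset.mem_product, mem_ncPartitions, mem_ncPartitions] at hQ
    obtain ⟨h₁, h₂⟩ := hQ
    simp only at h₁ h₂
    ext V
    · simp only [Finset.mem_insert, Finset.mem_union, Finset.mem_filter]
      constructor
      · rintro ⟨rfl | h | h, hV⟩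
        exacts [(hpI hV).elim, h, (disj V (h₂.nonempty V h) hV (h₂.subset V h)).elim]
      · exact fun h => ⟨Or.inr (Or.inl h), h₁.subset V h⟩
    · simp only [Finset.mem_insert, Finset.mem_union, Finset.mem_filter]
      constructor
      · rintro ⟨rfl | h | h, hV⟩
        exacts [(hpO hV).elim, (disj V (h₁.nonempty V h) (h₁.subset V h) hV).elim, h]
      · exact fun h => ⟨Or.inr (Or.inr h), h₂.subset V h⟩
  · intro P hP
    rw [Finset.mem_filter, mem_ncPartitions] at hP
    obtain ⟨hP, hp⟩ := hP
    simp only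
    rw [← Finset.prod_union]
    · refine Finset.prod_congr ?_ fun _ _ => rfl
      ext V
      simp only [Finset.mem_erase, Finset.mem_union, Finset.mem_filter]
      constructor
      · rintro ⟨hne, hV⟩
        exact (side P hP hp V hV hne).imp (fun h => ⟨hV, h⟩) fun h => ⟨hV, h⟩
      · rintro (⟨hV, h⟩ | ⟨hV, h⟩)
        · exact ⟨fun e => hpI (e ▸ h), hV⟩
        · exact ⟨fun e => hpO (e ▸ h), hV⟩
    · rw [Finset.disjoint_left]
      intro V h1 h2
      rw [Finset.mem_filter] at h1 h2
      exact disj V (hP.nonempty V h1.1) h1.2 h2.2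

theorem sum_range_sum_range (h : ℕ → ℂ) (n : ℕ) :
    ∑ j ∈ Finset.range n, ∑ d ∈ Finset.range j, h d =
      ∑ d ∈ Finset.range (n - 1), ((n : ℂ) - 1 - d) * h d := by
  induction n with
  | zero => simp
  | succ n ih =>
    rw [Finset.sum_range_succ, ih]
    rcases n with _ | n
    · simp
    · simp only [Nat.add_sub_cancel]
      rw [Finset.sum_range_succ _ n, Finset.sum_range_succ _ n, ← add_assoc,
        ← Finset.sum_add_distrib]
      congr 1
      · refine Finset.sum_congr rfl fun d _ => ?_
        push_cast
        ring
      · push_cast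
        ring

/-- Summing over the choices of a 2-element block in all non-crossing partitions gives, up to the
factor `n / 2`, the convolution of the moments. -/
theorem two_mul_sum_pairs (κ : ℕ → ℂ) (n : ℕ) :
    2 * ∑ P ∈ ncPartitions (Finset.univ : Finset (Fin n)), ∑ V ∈ P.filter (fun V => V.card = 2),
      ∏ W ∈ P.erase V, κ W.card =
    n * ∑ d ∈ Finset.range (n - 1), momentOf κ d * momentOf κ (n - 2 - d) := by
  classical
  set h : ℕ → ℂ := fun d => momentOf κ d * momentOf κ (n - 2 - d) with hh
  have pair : ∀ i j : Fin n, i < j →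
      ∑ P ∈ (ncPartitions Finset.univ).filter (fun P => {i, j} ∈ P),
        ∏ V ∈ P.erase {i, j}, κ V.card = h (j.val - 1 - i.val) := by
    intro i j hij
    rw [sum_prod_erase_pair κ _ (Finset.mem_univ i) (Finset.mem_univ j) hij, ncSum_eq_momentOf,
      ncSum_eq_momentOf, hh]
    have c1 : (Finset.univ.filter fun k => i < k ∧ k < j).card = j.val - 1 - i.val := by
      have : (Finset.univ.filter fun k => i < k ∧ k < j) = Finset.Ioo i j := by
        ext; simp
      rw [this, Fin.card_Ioo]
      omega
    have c2 : (Finset.univ.filter fun k => k < i ∨ j < k).card =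
        n - 2 - (j.val - 1 - i.val) := by
      have : (Finset.univ.filter fun k => k < i ∨ j < k) = Finset.Iio i ∪ Finset.Ioi j := by
        ext; simp
      rw [this, Finset.card_union_of_disjoint, Fin.card_Iio, Fin.card_Ioi]
      · have := j.isLt
        have : i.val < j.val := hij
        omega
      · rw [Finset.disjoint_left]
        intro k h1 h2
        simp only [Finset.mem_Iio, Finset.mem_Ioi] at h1 h2
        exact absurd (h1.trans hij) h2.not_gt
    simp only [c1, c2]
  have step : ∑ P ∈ ncPartitions (Finset.univ : Finset (Fin n)),
      ∑ V ∈ P.filter (fun V => V.card = 2), ∏ W ∈ P.erase V, κ W.card =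
      ∑ j ∈ Finset.range n, ∑ d ∈ Finset.range j, h d := by
    have swap : ∑ P ∈ ncPartitions (Finset.univ : Finset (Fin n)),
        ∑ V ∈ P.filter (fun V => V.card = 2), ∏ W ∈ P.erase V, κ W.card =
        ∑ V ∈ (Finset.univ : Finset (Finset (Fin n))).filter (fun V => V.card = 2),
          ∑ P ∈ (ncPartitions Finset.univ).filter (fun P => V ∈ P),
            ∏ W ∈ P.erase V, κ W.card := by
      refine Finset.sum_comm' fun P V => ?_
      simp only [Finset.mem_filter, Finset.mem_univ, true_and]
      tauto
    rw [swap]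
    have toPairs : ∑ V ∈ (Finset.univ : Finset (Finset (Fin n))).filter (fun V => V.card = 2),
          ∑ P ∈ (ncPartitions Finset.univ).filter (fun P => V ∈ P),
            ∏ W ∈ P.erase V, κ W.card =
        ∑ q ∈ (Finset.univ : Finset (Fin n × Fin n)).filter (fun q => q.2 < q.1),
          h (q.1.val - 1 - q.2.val) := by
      symm
      refine Finset.sum_bij (fun q _ => {q.2, q.1}) ?_ ?_ ?_ ?_
      · intro q hq
        simp only [Finset.mem_filter, Finset.mem_univ, true_and] at hq ⊢
        exact Finset.card_pair hq.ne
      · rintro ⟨a, b⟩ hq ⟨c, d⟩ hr e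
        simp only [Finset.mem_filter, Finset.mem_univ, true_and] at hq hr
        simp only [Finset.ext_iff, Finset.mem_insert, Finset.mem_singleton] at e
        have e1 := e a
        have e2 := e b
        have e3 := e c
        have e4 := e d
        simp only [Prod.mk.injEq]
        grind
      · intro V hV
        simp only [Finset.mem_filter, Finset.mem_univ, true_and] at hV
        obtain ⟨a, b, hab, rfl⟩ := Finset.card_eq_two.mp hV
        rcases lt_or_gt_of_ne hab with hlt | hlt
        · exact ⟨(b, a), by simpa using hlt, rfl⟩
        · exact ⟨(a, b), by simpa using hlt, Finset.pair_comm _ _⟩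
      · intro q hq
        simp only [Finset.mem_filter, Finset.mem_univ, true_and] at hq
        exact (pair _ _ hq).symm
    rw [toPairs, Finset.sum_filter, ← Finset.univ_product_univ, Finset.sum_product]
    rw [Finset.sum_range]
    refine Finset.sum_congr rfl fun j _ => ?_
    rw [← Finset.sum_range_reflect h j.val]
    simp only [Fin.lt_def]
    rw [← Fin.sum_univ_eq_sum_range (fun d => h (j.val - 1 - d)) j.val,
      Fin.sum_univ_eq_sum_range (fun d => if d < j.val then h (j.val - 1 - d) else 0) n,
      Fin.sum_univ_eq_sum_range (fun d => h (j.val - 1 - d)) j.val, ← Finset.sum_filter]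
    refine Finset.sum_congr ?_ fun _ _ => rfl
    ext d
    simp only [Finset.mem_filter, Finset.mem_range]
    have := j.isLt
    omega
  rw [step, sum_range_sum_range]
  -- average the sum with its reflection `d ↦ n - 2 - d`
  have reflect : ∑ d ∈ Finset.range (n - 1), ((n : ℂ) - 1 - d) * h d =
      ∑ d ∈ Finset.range (n - 1), ((d : ℂ) + 1) * h d := by
    rw [← Finset.sum_range_reflect]
    refine Finset.sum_congr rfl fun d hd => ?_
    rw [Finset.mem_range] at hd
    have e : n - 1 - 1 - d = n - 2 - d := by omega
    have e' : ((n - 2 - d : ℕ) : ℂ) = n - 2 - d := by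
      rw [Nat.cast_sub (by omega), Nat.cast_sub (by omega)]
      norm_num
    have e'' : n - 2 - (n - 2 - d) = d := by omega
    rw [e, e', hh]
    simp only [e'']
    ring
  rw [two_mul]
  nth_rewrite 2 [reflect]
  rw [Finset.mul_sum, ← Finset.sum_add_distrib]
  exact Finset.sum_congr rfl fun d _ => by ring

end Noncrossing

/-! ### Free cumulants of one variable -/

section Cumulants

/-- The moment-cumulant sum with the contribution of the one-block partition split off. -/
theorem sum_NC_eq_univ_add {R : Type*} [CommRing R] {n : ℕ} (hn : 1 ≤ n)
    (f : Finset (Fin n) → R) :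
    ∑ π ∈ NC n, ∏ V ∈ π.parts, f V = f Finset.univ +
      ∑ π ∈ (NC n).filter (fun π => Finset.univ ∉ π.parts), ∏ V ∈ π.parts, f V := by
  classical
  have hne : (Finset.univ : Finset (Fin n)) ≠ ⊥ := by
    have : Nonempty (Fin n) := ⟨⟨0, hn⟩⟩
    simpa using Finset.univ_nonempty.ne_empty
  have hone : (NC n).filter (fun π => Finset.univ ∈ π.parts) = {Finpartition.indiscrete hne} := by
    ext π
    simp only [NC, Finset.mem_filter, Finset.mem_univ, true_and, Finset.mem_singleton]
    constructor
    · rintro ⟨-, h⟩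
      ext V
      simp only [Finpartition.indiscrete_parts, Finset.mem_singleton]
      constructor
      · intro hV
        obtain ⟨i, hi⟩ := π.nonempty_of_mem_parts hV
        exact π.eq_of_mem_parts hV h hi (Finset.mem_univ i)
      · rintro rfl
        exact h
    · rintro rfl
      refine ⟨?_, by simp⟩
      intro V hV W hW
      simp only [Finpartition.indiscrete_parts, Finset.mem_singleton] at hV hW
      intros
      rw [hV, hW]
  rw [← Finset.sum_filter_add_sum_filter_not _ (fun π => Finset.univ ∈ π.parts), hone]
  simp

theorem card_lt_of_mem_parts {n : ℕ} {π : Finpartition (Finset.univ : Finset (Fin n))}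
    (hπ : Finset.univ ∉ π.parts) {V : Finset (Fin n)} (hV : V ∈ π.parts) : V.card < n := by
  have hV' : V ≠ Finset.univ := by
    rintro rfl
    exact hπ hV
  simpa using Finset.card_lt_card (Finset.ssubset_univ_iff.mpr hV')

/-- The free cumulant as the moment minus the contributions of all partitions with at least two
blocks. -/
theorem cumulant_eq_sub {α R : Type*} [CommRing R] (M : (n : ℕ) → (Fin n → α) → R)
    (n : ℕ) (a : Fin n → α) :
    cumulant M n a = M n a - ∑ π ∈ (NC n).filter (fun π => Finset.univ ∉ π.parts),
      ∏ V ∈ π.parts, cumulant M V.card (restrict a V) := by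
  rw [cumulant.eq_1 M n a]
  congr 1
  refine Finset.sum_congr rfl fun π hπ => Finset.prod_congr rfl fun V hV => ?_
  rw [dif_pos (card_lt_of_mem_parts (Finset.mem_filter.mp hπ).2 hV)]

/-- The cumulants of a single variable are determined by the moment-cumulant formula. -/
theorem cumulant_const_eq {α R : Type*} [CommRing R] (M : (n : ℕ) → (Fin n → α) → R) (a : α)
    (κ : ℕ → R)
    (h : ∀ n, 1 ≤ n → M n (fun _ => a) = ∑ π ∈ NC n, ∏ V ∈ π.parts, κ V.card) (n : ℕ)
    (hn : 1 ≤ n) : cumulant M n (fun _ => a) = κ n := by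
  induction n using Nat.strong_induction_on with
  | _ n ih =>
    rw [cumulant_eq_sub, h n hn, sum_NC_eq_univ_add hn, Finset.card_univ, Fintype.card_fin]
    rw [add_sub_assoc, add_eq_left, sub_eq_zero]
    refine Finset.sum_congr rfl fun π hπ => Finset.prod_congr rfl fun V hV => ?_
    exact (ih V.card (card_lt_of_mem_parts (Finset.mem_filter.mp hπ).2 hV)
      (Finset.card_pos.mpr (π.nonempty_of_mem_parts hV))).symm

theorem moment_const_eq_sum {α R : Type*} [CommRing R] (M : (n : ℕ) → (Fin n → α) → R) (a : α)
    (n : ℕ) (hn : 1 ≤ n) :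
    M n (fun _ => a) =
      ∑ π ∈ NC n, ∏ V ∈ π.parts, cumulant M V.card (fun _ => a) :=
  moment_eq_sum_cumulant M n hn _

theorem measureCumulant_eq (μ : Measure ℝ) (κ : ℕ → ℂ)
    (h : ∀ n, 1 ≤ n → ((∫ t, t ^ n ∂μ : ℝ) : ℂ) = ∑ π ∈ NC n, ∏ V ∈ π.parts, κ V.card)
    (n : ℕ) (hn : 1 ≤ n) : (measureCumulant μ n : ℂ) = κ n := by
  have h1 := cumulant_const_eq (fun m (_ : Fin m → Unit) => ((∫ t, t ^ m ∂μ : ℝ) : ℂ)) ()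
    (fun n => (measureCumulant μ n : ℂ)) ?_ n hn
  · rw [← h1]
    exact cumulant_const_eq (fun m (_ : Fin m → Unit) => ((∫ t, t ^ m ∂μ : ℝ) : ℂ)) () κ h n hn
  · intro k hk
    rw [moment_const_eq_sum (fun m (_ : Fin m → Unit) => ∫ t, t ^ m ∂μ) () k hk]
    push_cast
    rfl

variable {A : Type*} [Ring A] [Algebra ℂ A]

theorem freeCumulant₁_eq (φ : A →ₗ[ℂ] ℂ) (a : A) (κ : ℕ → ℂ)
    (h : ∀ n, 1 ≤ n → φ (a ^ n) = ∑ π ∈ NC n, ∏ V ∈ π.parts, κ V.card) (n : ℕ) (hn : 1 ≤ n) :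
    freeCumulant₁ φ n a = κ n := by
  refine cumulant_const_eq _ a κ (fun k hk => ?_) n hn
  rw [← h k hk, List.ofFn_const, List.prod_replicate]

theorem moment_eq_sum_freeCumulant₁ (φ : A →ₗ[ℂ] ℂ) (a : A) (n : ℕ) (hn : 1 ≤ n) :
    φ (a ^ n) = ∑ π ∈ NC n, ∏ V ∈ π.parts, freeCumulant₁ φ V.card a := by
  have := moment_const_eq_sum (fun m b => φ (List.ofFn (n := m) b).prod) a n hn
  rwa [List.ofFn_const, List.prod_replicate] at this

end Cumulants

/-! ### The complex Burgers equation for moments -/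

section Burgers

/-- The moments `m t n` evolve as those of `√v t S + Y`, with a standard semicircular element `S`
free from `Y`: the coefficientwise form of the complex Burgers equation. -/
def SatisfiesBurgers (v : ℂ) (m : ℂ → ℕ → ℂ) : Prop :=
  ∀ (n : ℕ) (t : ℂ), HasDerivAt (fun t => m t n)
    (v * t * (n * ∑ d ∈ Finset.range (n - 1), m t d * m t (n - 2 - d))) t

theorem SatisfiesBurgers.unique {v : ℂ} {m m' : ℂ → ℕ → ℂ} (h : SatisfiesBurgers v m)
    (h' : SatisfiesBurgers v m') (h0 : ∀ n, m 0 n = m' 0 n) (t : ℂ) (n : ℕ) : m t n = m' t n := by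
  induction n using Nat.strong_induction_on generalizing t with
  | _ n ih =>
    have hd : ∀ t, HasDerivAt (fun t => m t n - m' t n) 0 t := by
      intro t
      refine ((h n t).sub (h' n t)).congr_deriv ?_
      rw [sub_eq_zero]
      congr 2
      refine Finset.sum_congr rfl fun d hd => ?_
      rw [Finset.mem_range] at hd
      rw [ih d (by omega), ih (n - 2 - d) (by omega)]
    have := is_const_of_deriv_eq_zero (fun t => (hd t).differentiableAt)
      (fun t => (hd t).deriv) t 0
    simp only [h0, sub_self] at this
    exact sub_eq_zero.mp this

/-- Adding `v t²` to the second cumulant solves the Burgers equation. -/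
theorem satisfiesBurgers_momentOf (v : ℂ) (κ : ℕ → ℂ) :
    SatisfiesBurgers v
      (fun t n => momentOf (fun k => κ k + if k = 2 then v * t ^ 2 else 0) n) := by
  classical
  intro n t
  set K : ℂ → ℕ → ℂ := fun t k => κ k + if k = 2 then v * t ^ 2 else 0 with hK
  have hder : ∀ k, HasDerivAt (fun t => K t k) (if k = 2 then 2 * (v * t) else 0) t := by
    intro k
    by_cases hk : k = 2
    · simp only [hK, hk, if_true]
      refine (((hasDerivAt_pow 2 t).const_mul v).const_add (κ 2)).congr_deriv ?_
      push_cast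
      ring
    · simp only [hK, hk, if_false]
      exact hasDerivAt_const _ _
  have hsum : HasDerivAt (fun t => ∑ P ∈ ncPartitions (Finset.univ : Finset (Fin n)),
      ∏ V ∈ P, K t V.card) (∑ P ∈ ncPartitions (Finset.univ : Finset (Fin n)),
        ∑ V ∈ P, (∏ W ∈ P.erase V, K t W.card) • (if V.card = 2 then 2 * (v * t) else 0)) t :=
    HasDerivAt.fun_sum fun P _ => HasDerivAt.fun_finsetProd fun V _ => hder V.card
  refine hsum.congr_deriv ?_
  change (_ : ℂ) = v * t * ((n : ℂ) * ∑ d ∈ Finset.range (n - 1),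
    momentOf (K t) d * momentOf (K t) (n - 2 - d))
  rw [← two_mul_sum_pairs, ← mul_assoc (v * t) 2, Finset.mul_sum]
  refine Finset.sum_congr rfl fun P _ => ?_
  rw [Finset.sum_filter, Finset.mul_sum]
  refine Finset.sum_congr rfl fun V _ => ?_
  split_ifs
  · rw [smul_eq_mul]
    ring
  · simp

variable {A : Type*} [Ring A] [Algebra ℂ A]

theorem momentOf_zero (κ : ℕ → ℂ) : momentOf κ 0 = 1 := by
  have : ncPartitions (Finset.univ : Finset (Fin 0)) = {∅} := by
    ext P
    rw [mem_ncPartitions, Finset.mem_singleton]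
    constructor
    · intro h
      refine Finset.eq_empty_of_forall_notMem fun V hV => ?_
      obtain ⟨x, -⟩ := h.nonempty V hV
      exact x.elim0
    · rintro rfl
      constructor <;> simp
  rw [momentOf, ncSum, this]
  simp

/-- If the moments of `X` are the values at time `1` of a solution of the Burgers equation that
starts with the moments of `y`, then `X` has the cumulants of `y`, except that `v` is added to
`κ₂`. -/
theorem SatisfiesBurgers.freeCumulant₁_eq {φ : A →ₗ[ℂ] ℂ} (h1 : φ 1 = 1) {v : ℂ}
    {m : ℂ → ℕ → ℂ} (h : SatisfiesBurgers v m) {X y : A} (hy : ∀ n, m 0 n = φ (y ^ n))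
    (hX : ∀ n, m 1 n = φ (X ^ n)) (n : ℕ) (hn : 1 ≤ n) :
    freeCumulant₁ φ n X = freeCumulant₁ φ n y + if n = 2 then v else 0 := by
  refine FreeProb.freeCumulant₁_eq φ X (fun k => freeCumulant₁ φ k y + if k = 2 then v else 0)
    (fun k hk => ?_) n hn
  rw [← hX, ← momentOf_eq_sum_NC (fun k => freeCumulant₁ φ k y + if k = 2 then v else 0)]
  have := h.unique (satisfiesBurgers_momentOf v (fun k => freeCumulant₁ φ k y)) (fun l => ?_) 1 k
  · simpa using this
  · rw [hy]
    rcases Nat.eq_zero_or_pos l with rfl | hl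
    · rw [momentOf_zero, pow_zero, h1]
    · rw [moment_eq_sum_freeCumulant₁ φ y l hl, momentOf_eq_sum_NC]
      simp

end Burgers

/-! ### Reduced words in two free subalgebras -/

section Words

variable {A : Type*} [Ring A] [Algebra ℂ A]

/-- Products `d₁ a₁ d₂ a₂ ⋯ d_k a_k` with `k ≥ 1`, `d_i ∈ A₂` and `a_i ∈ A₁`, in which all factors
but possibly the last one are centered. -/
inductive IsReducedWord (φ : A →ₗ[ℂ] ℂ) (A₁ A₂ : Subalgebra ℂ A) : A → Prop
  | single {d a : A} (hd : d ∈ A₂) (hd0 : φ d = 0) (ha : a ∈ A₁) :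
      IsReducedWord φ A₁ A₂ (d * a)
  | cons {d a w : A} (hd : d ∈ A₂) (hd0 : φ d = 0) (ha : a ∈ A₁) (ha0 : φ a = 0)
      (hw : IsReducedWord φ A₁ A₂ w) : IsReducedWord φ A₁ A₂ (d * (a * w))

theorem map_sub_algebraMap {φ : A →ₗ[ℂ] ℂ} (h1 : φ 1 = 1) (a : A) :
    φ (a - algebraMap ℂ A (φ a)) = 0 := by
  rw [map_sub, Algebra.algebraMap_eq_smul_one, map_smul, h1, smul_eq_mul, mul_one, sub_self]

theorem sub_algebraMap_mem {S : Subalgebra ℂ A} {a : A} (ha : a ∈ S) (c : ℂ) :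
    a - algebraMap ℂ A c ∈ S :=
  S.sub_mem ha (S.algebraMap_mem c)

theorem IsReducedWord.mul_right {φ : A →ₗ[ℂ] ℂ} {A₁ A₂ : Subalgebra ℂ A} {w a : A}
    (hw : IsReducedWord φ A₁ A₂ w) (ha : a ∈ A₁) : IsReducedWord φ A₁ A₂ (w * a) := by
  induction hw with
  | single hd hd0 hb =>
    rw [mul_assoc]
    exact .single hd hd0 (mul_mem hb ha)
  | cons hd hd0 hb hb0 _ ih =>
    rw [mul_assoc, mul_assoc]
    exact .cons hd hd0 hb hb0 ih

/-- The elements `a` and `a w` with `a ∈ A₁` and a reduced word `w` span the algebra generated by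
`A₁` and `A₂`. -/
theorem mem_span_reducedWords {φ : A →ₗ[ℂ] ℂ} (h1 : φ 1 = 1) {A₁ A₂ : Subalgebra ℂ A} {P : A}
    (hP : P ∈ Algebra.adjoin ℂ ((A₁ : Set A) ∪ A₂)) :
    P ∈ Submodule.span ℂ
      {p | p ∈ A₁ ∨ ∃ a ∈ A₁, ∃ w, IsReducedWord φ A₁ A₂ w ∧ p = a * w} := by
  set V := Submodule.span ℂ {p | p ∈ A₁ ∨ ∃ a ∈ A₁, ∃ w, IsReducedWord φ A₁ A₂ w ∧ p = a * w}
    with hV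
  have m1 : ∀ a ∈ A₁, a ∈ V := fun a ha => Submodule.subset_span (Or.inl ha)
  have m2 : ∀ a ∈ A₁, ∀ w, IsReducedWord φ A₁ A₂ w → a * w ∈ V := fun a ha w hw =>
    Submodule.subset_span (Or.inr ⟨a, ha, w, hw, rfl⟩)
  have m3 : ∀ w, IsReducedWord φ A₁ A₂ w → w ∈ V := fun w hw => by
    simpa using m2 1 A₁.one_mem w hw
  have split : ∀ c z : A, c * z = (c - algebraMap ℂ A (φ c)) * z + φ c • z := fun c z => by
    rw [sub_mul, Algebra.smul_def]
    abel
  -- `V` is stable under left multiplication by a centered element of `A₂`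
  have centered : ∀ d ∈ A₂, φ d = 0 → ∀ z ∈ V, d * z ∈ V := by
    intro d hd hd0 z hz
    induction hz using Submodule.span_induction with
    | zero => simp
    | add y z _ _ hy hz =>
      rw [mul_add]
      exact V.add_mem hy hz
    | smul c y _ hy =>
      rw [mul_smul_comm]
      exact V.smul_mem c hy
    | mem z hz =>
      rcases hz with hz | ⟨a, ha, w, hw, rfl⟩
      · exact m3 _ (.single hd hd0 hz)
      · rw [split a w, mul_add, mul_smul_comm]
        refine V.add_mem (m3 _ (.cons hd hd0 (sub_algebraMap_mem ha _) (map_sub_algebraMap h1 a)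
          hw)) (V.smul_mem _ ?_)
        cases hw with
        | single he he0 hb =>
          rw [← mul_assoc, split]
          exact V.add_mem (m3 _ (.single (sub_algebraMap_mem (mul_mem hd he) _)
            (map_sub_algebraMap h1 _) hb)) (V.smul_mem _ (m1 _ hb))
        | cons he he0 hb hb0 hw' =>
          rw [← mul_assoc, split]
          exact V.add_mem (m3 _ (.cons (sub_algebraMap_mem (mul_mem hd he) _)
            (map_sub_algebraMap h1 _) hb hb0 hw')) (V.smul_mem _ (m2 _ hb _ hw'))
  have stable : ∀ z ∈ V, P * z ∈ V := by
    induction hP using Algebra.adjoin_induction with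
    | algebraMap c =>
      intro z hz
      rw [← Algebra.smul_def]
      exact V.smul_mem c hz
    | add x y _ _ hx hy =>
      intro z hz
      rw [add_mul]
      exact V.add_mem (hx z hz) (hy z hz)
    | mul x y _ _ hx hy =>
      intro z hz
      rw [mul_assoc]
      exact hx _ (hy z hz)
    | mem x hx =>
      intro z hz
      rcases hx with hx | hx
      · induction hz using Submodule.span_induction with
        | zero => simp
        | add y z _ _ hy hz =>
          rw [mul_add]
          exact V.add_mem hy hz
        | smul c y _ hy =>
          rw [mul_smul_comm]
          exact V.smul_mem c hy
        | mem z hz =>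
          rcases hz with hz | ⟨a, ha, w, hw, rfl⟩
          · exact m1 _ (mul_mem hx hz)
          · rw [← mul_assoc]
            exact m2 _ (mul_mem hx ha) _ hw
      · rw [split]
        exact V.add_mem (centered _ (sub_algebraMap_mem hx _) (map_sub_algebraMap h1 x) z hz)
          (V.smul_mem _ hz)
  simpa using stable 1 (m1 1 A₁.one_mem)

/-- Freeness in the form used below: `φ` vanishes on `a w` for `a ∈ A₁` and reduced `w`. -/
theorem FreeSubalgebras.map_mul_reducedWord {ι : Type*} {φ : A →ₗ[ℂ] ℂ}
    {S : ι → Subalgebra ℂ A} (hS : FreeSubalgebras φ S) (h1 : φ 1 = 1) {i j : ι} (hij : i ≠ j)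
    {a w : A} (ha : a ∈ S i) (hw : IsReducedWord φ (S i) (S j) w) : φ (a * w) = 0 := by
  have key : ∀ w, IsReducedWord φ (S i) (S j) w → ∀ l : List (ι × A),
      (∀ p ∈ l, p.2 ∈ S p.1 ∧ φ p.2 = 0) → l.IsChain (fun p q => p.1 ≠ q.1) →
      (∀ p ∈ l.getLast?, p.1 ≠ j) → φ ((l.map Prod.snd).prod * w) = 0 := by
    intro w hw
    induction hw with
    | @single d b hd hd0 hb =>
      intro l hl hc hlast
      have e1 := hS (l ++ [(j, d), (i, b - algebraMap ℂ A (φ b))]) (by simp) (by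
        intro p hp
        simp only [List.mem_append, List.mem_cons, List.not_mem_nil, or_false] at hp
        rcases hp with hp | rfl | rfl
        exacts [hl p hp, ⟨hd, hd0⟩, ⟨sub_algebraMap_mem hb _, map_sub_algebraMap h1 b⟩]) (by
        refine List.isChain_append.mpr ⟨hc, by simpa using hij.symm, ?_⟩
        simpa using hlast)
      have e2 := hS (l ++ [(j, d)]) (by simp) (by
        intro p hp
        simp only [List.mem_append, List.mem_cons, List.not_mem_nil, or_false] at hp
        rcases hp with hp | rfl
        exacts [hl p hp, ⟨hd, hd0⟩]) (by
        refine List.isChain_append.mpr ⟨hc, by simp, ?_⟩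
        simpa using hlast)
      simp only [List.map_append, List.map_cons, List.map_nil, List.prod_append, List.prod_cons,
        List.prod_nil, mul_one] at e1 e2
      rw [mul_sub, mul_sub, map_sub, sub_eq_zero] at e1
      rw [e1, ← Algebra.commutes, ← Algebra.smul_def, mul_smul_comm, map_smul, e2, smul_zero]
    | @cons d b w hd hd0 hb hb0 _ ih =>
      intro l hl hc hlast
      have := ih (l ++ [(j, d), (i, b)]) (by
        intro p hp
        simp only [List.mem_append, List.mem_cons, List.not_mem_nil, or_false] at hp
        rcases hp with hp | rfl | rfl
        exacts [hl p hp, ⟨hd, hd0⟩, ⟨hb, hb0⟩]) (by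
        refine List.isChain_append.mpr ⟨hc, by simpa using hij.symm, ?_⟩
        simpa using hlast) (by simpa using hij)
      simpa [mul_assoc] using this
  have e1 := key w hw [(i, a - algebraMap ℂ A (φ a))] (by
    intro p hp
    obtain rfl := List.mem_singleton.mp hp
    exact ⟨sub_algebraMap_mem ha _, map_sub_algebraMap h1 a⟩) (by simp) (by simpa using hij)
  have e2 := key w hw [] (by simp) (by simp) (by simp)
  simp only [List.map_cons, List.map_nil, List.prod_cons, List.prod_nil, mul_one, one_mul,
    sub_mul, map_sub, sub_eq_zero] at e1 e2
  rw [e1, ← Algebra.smul_def, map_smul, e2, smul_zero]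

/-- Elements of `A₁` commute under `φ` with the algebra generated by `A₁` and `A₂`, if they do so
with `A₁`: on `a w` with `w` reduced, both sides vanish. -/
theorem map_mul_comm_of_mem {φ : A →ₗ[ℂ] ℂ} (h1 : φ 1 = 1) {A₁ A₂ : Subalgebra ℂ A}
    (hv : ∀ a ∈ A₁, ∀ w, IsReducedWord φ A₁ A₂ w → φ (a * w) = 0)
    (hc : ∀ a ∈ A₁, ∀ b ∈ A₁, φ (a * b) = φ (b * a)) {c P : A} (hcA : c ∈ A₁)
    (hP : P ∈ Algebra.adjoin ℂ ((A₁ : Set A) ∪ A₂)) : φ (c * P) = φ (P * c) := by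
  replace hP := mem_span_reducedWords h1 hP
  induction hP using Submodule.span_induction with
  | zero => simp
  | add x y _ _ hx hy => rw [mul_add, add_mul, map_add, map_add, hx, hy]
  | smul r x _ hx => rw [mul_smul_comm, smul_mul_assoc, map_smul, map_smul, hx]
  | mem z hz =>
    rcases hz with hz | ⟨a, ha, w, hw, rfl⟩
    · exact hc c hcA z hz
    · rw [mul_assoc, hv a ha _ (hw.mul_right hcA), ← mul_assoc, hv _ (mul_mem hcA ha) w hw]

theorem commute_of_mem_adjoin_singleton {a x y : A} (hx : x ∈ Algebra.adjoin ℂ {a})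
    (hy : y ∈ Algebra.adjoin ℂ {a}) : x * y = y * x := by
  rw [Algebra.adjoin_singleton_eq_range_aeval] at hx hy
  obtain ⟨p, rfl⟩ := hx
  obtain ⟨q, rfl⟩ := hy
  simp only [AlgHom.toRingHom_eq_coe, RingHom.coe_coe, ← map_mul, mul_comm]

/-- A functional is tracial on the algebra generated by two free elements, whether or not it is
tracial on the ambient algebra. -/
theorem Free.map_mul_comm {φ : A →ₗ[ℂ] ℂ} (h1 : φ 1 = 1) {a b : A} (h : Free φ a b) {P Q : A}
    (hP : P ∈ Algebra.adjoin ℂ ((Algebra.adjoin ℂ {a} : Set A) ∪ Algebra.adjoin ℂ {b}))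
    (hQ : Q ∈ Algebra.adjoin ℂ ((Algebra.adjoin ℂ {a} : Set A) ∪ Algebra.adjoin ℂ {b})) :
    φ (P * Q) = φ (Q * P) := by
  induction hP using Algebra.adjoin_induction generalizing Q with
  | algebraMap c => rw [Algebra.commutes]
  | add x y _ _ hx hy => rw [mul_add, add_mul, map_add, map_add, hx hQ, hy hQ]
  | mul x y hx' hy' hx hy =>
    rw [mul_assoc, hx (mul_mem hy' hQ), mul_assoc, hy (mul_mem hQ hx'), mul_assoc]
  | mem x hx =>
    rcases hx with hx | hx
    · exact map_mul_comm_of_mem h1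
        (fun c hc w hw => FreeSubalgebras.map_mul_reducedWord h h1 (i := true) (j := false)
          (by simp) hc hw)
        (fun c hc d hd => by rw [commute_of_mem_adjoin_singleton hc hd]) hx hQ
    · rw [Set.union_comm] at hQ
      exact map_mul_comm_of_mem h1
        (fun c hc w hw => FreeSubalgebras.map_mul_reducedWord h h1 (i := false) (j := true)
          (by simp) hc hw)
        (fun c hc d hd => by rw [commute_of_mem_adjoin_singleton hc hd]) hx hQ

end Words

/-! ### The free difference quotient and the Schwinger-Dyson equation -/

section SchwingerDyson

open scoped TensorProduct

variable {A : Type*} [Ring A] [Algebra ℂ A]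

/-- The functional `φ ⊗ φ` on `A ⊗ A`. -/
noncomputable def tensorSq (φ : A →ₗ[ℂ] ℂ) : A ⊗[ℂ] A →ₗ[ℂ] ℂ :=
  LinearMap.mul' ℂ ℂ ∘ₗ TensorProduct.map φ φ

@[simp]
theorem tensorSq_tmul (φ : A →ₗ[ℂ] ℂ) (a b : A) : tensorSq φ (a ⊗ₜ b) = φ a * φ b := rfl

/-- An element `p` together with a value `Θ` of the free difference quotient at `p`. Products of
these matrices encode the Leibniz rule `∂(pq) = (p ⊗ 1) ∂q + ∂p (1 ⊗ q)`; in this form no relations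
between the generators have to be respected. -/
def quotientMatrix (p : A) (Θ : A ⊗[ℂ] A) : Matrix (Fin 2) (Fin 2) (A ⊗[ℂ] A) :=
  !![p ⊗ₜ 1, Θ; 0, 1 ⊗ₜ p]

@[simp]
theorem quotientMatrix_zero_zero (p : A) (Θ : A ⊗[ℂ] A) : quotientMatrix p Θ 0 0 = p ⊗ₜ 1 := rfl

@[simp]
theorem quotientMatrix_zero_one (p : A) (Θ : A ⊗[ℂ] A) : quotientMatrix p Θ 0 1 = Θ := rfl

theorem quotientMatrix_mul (p q : A) (Θ Ξ : A ⊗[ℂ] A) :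
    quotientMatrix p Θ * quotientMatrix q Ξ =
      quotientMatrix (p * q) (p ⊗ₜ 1 * Ξ + Θ * 1 ⊗ₜ q) := by
  simp [quotientMatrix, Algebra.TensorProduct.tmul_mul_tmul]

theorem quotientMatrix_add (p q : A) (Θ Ξ : A ⊗[ℂ] A) :
    quotientMatrix p Θ + quotientMatrix q Ξ = quotientMatrix (p + q) (Θ + Ξ) := by
  simp [quotientMatrix, TensorProduct.add_tmul, TensorProduct.tmul_add]

theorem quotientMatrix_sub (p q : A) (Θ Ξ : A ⊗[ℂ] A) :
    quotientMatrix p Θ - quotientMatrix q Ξ = quotientMatrix (p - q) (Θ - Ξ) := by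
  simp [quotientMatrix, TensorProduct.sub_tmul, TensorProduct.tmul_sub]

theorem smul_quotientMatrix (c : ℂ) (p : A) (Θ : A ⊗[ℂ] A) :
    c • quotientMatrix p Θ = quotientMatrix (c • p) (c • Θ) := by
  simp [quotientMatrix, TensorProduct.smul_tmul']

theorem quotientMatrix_one : quotientMatrix (1 : A) 0 = 1 := by
  ext i j
  fin_cases i <;> fin_cases j <;> simp [quotientMatrix, Algebra.TensorProduct.one_def]

theorem quotientMatrix_algebraMap (c : ℂ) :
    algebraMap ℂ (Matrix (Fin 2) (Fin 2) (A ⊗[ℂ] A)) c =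
      quotientMatrix (algebraMap ℂ A c) 0 := by
  rw [Algebra.algebraMap_eq_smul_one, ← quotientMatrix_one, smul_quotientMatrix, smul_zero,
    Algebra.algebraMap_eq_smul_one]

theorem quotientMatrix_pow (p : A) (Θ : A ⊗[ℂ] A) (n : ℕ) :
    quotientMatrix p Θ ^ n = quotientMatrix (p ^ n)
      (∑ d ∈ Finset.range n, (p ^ d) ⊗ₜ 1 * Θ * 1 ⊗ₜ (p ^ (n - 1 - d))) := by
  induction n with
  | zero => simp [quotientMatrix_one]
  | succ n ih =>
    rw [pow_succ, ih, quotientMatrix_mul, ← pow_succ]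
    congr 1
    rw [Finset.sum_range_succ, add_comm]
    congr 1
    · rw [Finset.sum_mul]
      refine Finset.sum_congr rfl fun d hd => ?_
      rw [Finset.mem_range] at hd
      rw [mul_assoc _ _ (1 ⊗ₜ p), Algebra.TensorProduct.tmul_mul_tmul, one_mul, ← pow_succ]
      congr 3
      omega
    · simp [← Algebra.TensorProduct.one_def]

/-- The elements of `D` with difference quotient zero. -/
def constantSubalgebra (D : Subalgebra ℂ A) :
    Subalgebra ℂ (Matrix (Fin 2) (Fin 2) (A ⊗[ℂ] A)) where
  carrier := {M | ∃ d ∈ D, M = quotientMatrix d 0}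
  mul_mem' := by
    rintro _ _ ⟨d, hd, rfl⟩ ⟨e, he, rfl⟩
    exact ⟨d * e, mul_mem hd he, by simp [quotientMatrix_mul]⟩
  add_mem' := by
    rintro _ _ ⟨d, hd, rfl⟩ ⟨e, he, rfl⟩
    exact ⟨d + e, add_mem hd he, by simp [quotientMatrix_add]⟩
  algebraMap_mem' c := ⟨_, D.algebraMap_mem c, quotientMatrix_algebraMap c⟩

/-- The span of the elementary tensors with both factors in `S`. -/
def tensorSpan (S : Subalgebra ℂ A) : Submodule ℂ (A ⊗[ℂ] A) :=
  Submodule.span ℂ {Θ | ∃ b ∈ S, ∃ c ∈ S, Θ = b ⊗ₜ c}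

theorem tensorSpan_mul {S : Subalgebra ℂ A} {a c : A} (ha : a ∈ S) (hc : c ∈ S)
    {Θ : A ⊗[ℂ] A} (hΘ : Θ ∈ tensorSpan S) : a ⊗ₜ 1 * Θ * 1 ⊗ₜ c ∈ tensorSpan S := by
  induction hΘ using Submodule.span_induction with
  | zero => simp
  | add x y _ _ hx hy =>
    rw [mul_add, add_mul]
    exact add_mem hx hy
  | smul r x _ hx =>
    rw [mul_smul_comm, smul_mul_assoc]
    exact Submodule.smul_mem _ r hx
  | mem x hx =>
    obtain ⟨b, hb, e, he, rfl⟩ := hx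
    refine Submodule.subset_span ⟨a * b, mul_mem ha hb, e * c, mul_mem he hc, ?_⟩
    simp [Algebra.TensorProduct.tmul_mul_tmul]

theorem mem_adjoin_quotientMatrix {s : A} {M : Matrix (Fin 2) (Fin 2) (A ⊗[ℂ] A)}
    (hM : M ∈ Algebra.adjoin ℂ {quotientMatrix s 1}) :
    ∃ a ∈ Algebra.adjoin ℂ {s}, ∃ Θ ∈ tensorSpan (Algebra.adjoin ℂ {s}),
      M = quotientMatrix a Θ := by
  have hone : ∀ {a}, a ∈ Algebra.adjoin ℂ {s} → ∀ {Θ}, Θ ∈ tensorSpan (Algebra.adjoin ℂ {s}) →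
      a ⊗ₜ 1 * Θ ∈ tensorSpan (Algebra.adjoin ℂ {s}) := fun ha Θ hΘ => by
    simpa [← Algebra.TensorProduct.one_def] using tensorSpan_mul ha (one_mem _) hΘ
  have hone' : ∀ {a}, a ∈ Algebra.adjoin ℂ {s} → ∀ {Θ}, Θ ∈ tensorSpan (Algebra.adjoin ℂ {s}) →
      Θ * 1 ⊗ₜ a ∈ tensorSpan (Algebra.adjoin ℂ {s}) := fun ha Θ hΘ => by
    simpa [← Algebra.TensorProduct.one_def] using tensorSpan_mul (one_mem _) ha hΘ
  induction hM using Algebra.adjoin_induction with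
  | algebraMap c =>
    exact ⟨_, Subalgebra.algebraMap_mem _ c, 0, zero_mem _, quotientMatrix_algebraMap c⟩
  | add x y _ _ hx hy =>
    obtain ⟨a, ha, Θ, hΘ, rfl⟩ := hx
    obtain ⟨b, hb, Ξ, hΞ, rfl⟩ := hy
    exact ⟨_, add_mem ha hb, _, add_mem hΘ hΞ, quotientMatrix_add _ _ _ _⟩
  | mul x y _ _ hx hy =>
    obtain ⟨a, ha, Θ, hΘ, rfl⟩ := hx
    obtain ⟨b, hb, Ξ, hΞ, rfl⟩ := hy
    exact ⟨_, mul_mem ha hb, _, add_mem (hone ha hΞ) (hone' hb hΘ), quotientMatrix_mul _ _ _ _⟩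
  | mem x hx =>
    obtain rfl := Set.mem_singleton_iff.mp hx
    exact ⟨s, Algebra.self_mem_adjoin_singleton ℂ s, 1,
      Submodule.subset_span ⟨1, one_mem _, 1, one_mem _, rfl⟩, rfl⟩

theorem tensorSq_mul_eq_zero_of_left {φ : A →ₗ[ℂ] ℂ} {S : Subalgebra ℂ A} {p : A}
    (hp : ∀ b ∈ S, φ (p * b) = 0) {Θ : A ⊗[ℂ] A} (hΘ : Θ ∈ tensorSpan S) (q : A) :
    tensorSq φ (p ⊗ₜ 1 * Θ * 1 ⊗ₜ q) = 0 := by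
  induction hΘ using Submodule.span_induction with
  | zero => simp
  | add x y _ _ hx hy => rw [mul_add, add_mul, map_add, hx, hy, add_zero]
  | smul r x _ hx => rw [mul_smul_comm, smul_mul_assoc, map_smul, hx, smul_zero]
  | mem x hx =>
    obtain ⟨b, hb, c, hc, rfl⟩ := hx
    simp [Algebra.TensorProduct.tmul_mul_tmul, hp b hb]

theorem tensorSq_mul_eq_zero_of_right {φ : A →ₗ[ℂ] ℂ} {S : Subalgebra ℂ A} {q : A}
    (hq : ∀ b ∈ S, φ (b * q) = 0) {Θ : A ⊗[ℂ] A} (hΘ : Θ ∈ tensorSpan S) (p : A) :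
    tensorSq φ (p ⊗ₜ 1 * Θ * 1 ⊗ₜ q) = 0 := by
  induction hΘ using Submodule.span_induction with
  | zero => simp
  | add x y _ _ hx hy => rw [mul_add, add_mul, map_add, hx, hy, add_zero]
  | smul r x _ hx => rw [mul_smul_comm, smul_mul_assoc, map_smul, hx, smul_zero]
  | mem x hx =>
    obtain ⟨b, hb, c, hc, rfl⟩ := hx
    simp [Algebra.TensorProduct.tmul_mul_tmul, hq c hc]

/-- A reduced word in the matrix algebra lies over a reduced word in `A`, and `φ ⊗ φ` vanishes on
its difference quotient, even after multiplication from the left by prefixes of reduced words. -/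
theorem reducedWord_quotientMatrix {φ : A →ₗ[ℂ] ℂ} (h1 : φ 1 = 1) {s : A} {D : Subalgebra ℂ A}
    {M : Matrix (Fin 2) (Fin 2) (A ⊗[ℂ] A)}
    (hM : IsReducedWord (tensorSq φ ∘ₗ Matrix.entryLinearMap ℂ (A ⊗[ℂ] A) 0 0)
      (Algebra.adjoin ℂ {quotientMatrix s 1}) (constantSubalgebra D) M) :
    ∃ w Θ, M = quotientMatrix w Θ ∧ IsReducedWord φ (Algebra.adjoin ℂ {s}) D w ∧
      ∀ p, (∀ w', IsReducedWord φ (Algebra.adjoin ℂ {s}) D w' → φ (p * w') = 0) →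
        tensorSq φ (p ⊗ₜ 1 * Θ) = 0 := by
  induction hM with
  | @single d a hd hd0 ha =>
    obtain ⟨d, hd, rfl⟩ := hd
    obtain ⟨a, ha', Θ, hΘ, rfl⟩ := mem_adjoin_quotientMatrix ha
    have hd0 : φ d = 0 := by simpa [h1] using hd0
    refine ⟨d * a, d ⊗ₜ 1 * Θ, by simp [quotientMatrix_mul], .single hd hd0 ha', fun p hp => ?_⟩
    have := tensorSq_mul_eq_zero_of_left (φ := φ) (p := p * d)
      (fun b hb => by rw [mul_assoc]; exact hp _ (.single hd hd0 hb)) hΘ 1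
    simpa [← mul_assoc, Algebra.TensorProduct.tmul_mul_tmul, ← Algebra.TensorProduct.one_def]
      using this
  | @cons d a w hd hd0 ha ha0 hw ih =>
    obtain ⟨d, hd, rfl⟩ := hd
    obtain ⟨a, ha', Θ, hΘ, rfl⟩ := mem_adjoin_quotientMatrix ha
    obtain ⟨w, Ξ, rfl, hw, hΞ⟩ := ih
    have hd0 : φ d = 0 := by simpa [h1] using hd0
    have ha0 : φ a = 0 := by simpa [h1] using ha0
    refine ⟨d * (a * w), d ⊗ₜ 1 * (a ⊗ₜ 1 * Ξ + Θ * 1 ⊗ₜ w), by simp [quotientMatrix_mul],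
      .cons hd hd0 ha' ha0 hw, fun p hp => ?_⟩
    have e1 := tensorSq_mul_eq_zero_of_left (φ := φ) (p := p * d)
      (fun b hb => by rw [mul_assoc]; exact hp _ (.single hd hd0 hb)) hΘ w
    have e2 := hΞ (p * d * a) fun w' hw' => by
      rw [mul_assoc, mul_assoc]
      exact hp _ (.cons hd hd0 ha' ha0 hw')
    have : p ⊗ₜ 1 * (d ⊗ₜ 1 * (a ⊗ₜ 1 * Ξ + Θ * 1 ⊗ₜ w)) =
        (p * d * a) ⊗ₜ[ℂ] 1 * Ξ + (p * d) ⊗ₜ[ℂ] 1 * Θ * 1 ⊗ₜ w := by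
      simp only [mul_add, ← mul_assoc, Algebra.TensorProduct.tmul_mul_tmul, one_mul]
    rw [this, map_add, e1, e2, add_zero]

/-- The Schwinger-Dyson equation `φ(s p) = v (φ ⊗ φ)(∂p)` for a semicircular element `s` of variance
`v`, and `p` in the algebra generated by `s` and an algebra `D` free from `s`. -/
theorem schwinger_dyson {φ : A →ₗ[ℂ] ℂ} (h1 : φ 1 = 1) {s : A} {v : ℂ}
    (hs : ∀ n, φ (s ^ (n + 1)) = v * ∑ d ∈ Finset.range n, φ (s ^ d) * φ (s ^ (n - 1 - d)))
    {D : Subalgebra ℂ A}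
    (hv : ∀ a ∈ Algebra.adjoin ℂ {s}, ∀ w, IsReducedWord φ (Algebra.adjoin ℂ {s}) D w →
      φ (a * w) = 0)
    {p : A} {Θ : A ⊗[ℂ] A}
    (hp : quotientMatrix p Θ ∈ Algebra.adjoin ℂ
      ((Algebra.adjoin ℂ {quotientMatrix s 1} : Set (Matrix (Fin 2) (Fin 2) (A ⊗[ℂ] A))) ∪
        constantSubalgebra D)) :
    φ (s * p) = v * tensorSq φ Θ := by
  have key : ∀ M ∈ Algebra.adjoin ℂ
      ((Algebra.adjoin ℂ {quotientMatrix s 1} : Set (Matrix (Fin 2) (Fin 2) (A ⊗[ℂ] A))) ∪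
        constantSubalgebra D),
      tensorSq φ (s ⊗ₜ 1 * M 0 0) = v * tensorSq φ (M 0 1) := by
    intro M hM
    replace hM := mem_span_reducedWords
      (φ := tensorSq φ ∘ₗ Matrix.entryLinearMap ℂ (A ⊗[ℂ] A) 0 0)
      (by simp [Algebra.TensorProduct.one_def, h1]) hM
    have hself := Algebra.self_mem_adjoin_singleton ℂ s
    induction hM using Submodule.span_induction with
    | zero => simp
    | add x y _ _ hx hy =>
      rw [Matrix.add_apply, Matrix.add_apply, mul_add, map_add, map_add, hx, hy, mul_add]
    | smul r x _ hx =>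
      rw [Matrix.smul_apply, Matrix.smul_apply, mul_smul_comm, map_smul, map_smul, hx,
        mul_smul_comm]
    | mem M hM =>
      rcases hM with hM | ⟨a, ha, w, hw, rfl⟩
      · rw [← Subalgebra.mem_toSubmodule, Algebra.adjoin_eq_span] at hM
        induction hM using Submodule.span_induction with
        | zero => simp
        | add x y _ _ hx hy =>
          rw [Matrix.add_apply, Matrix.add_apply, mul_add, map_add, map_add, hx, hy, mul_add]
        | smul r x _ hx =>
          rw [Matrix.smul_apply, Matrix.smul_apply, mul_smul_comm, map_smul, map_smul, hx,
            mul_smul_comm]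
        | mem x hx =>
          obtain ⟨n, rfl⟩ := Submonoid.mem_closure_singleton.mp hx
          rw [quotientMatrix_pow]
          simp [Algebra.TensorProduct.tmul_mul_tmul, h1, ← pow_succ', hs]
      · obtain ⟨a, ha', Θ, hΘ, rfl⟩ := mem_adjoin_quotientMatrix ha
        obtain ⟨w, Ξ, rfl, hw, hΞ⟩ := reducedWord_quotientMatrix h1 hw
        rw [quotientMatrix_mul, quotientMatrix_zero_zero, quotientMatrix_zero_one, map_add,
          hΞ a (hv a ha'), Algebra.TensorProduct.tmul_mul_tmul, tensorSq_tmul, ← mul_assoc s,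
          hv _ (mul_mem hself ha') w hw]
        have := tensorSq_mul_eq_zero_of_right (φ := φ) (fun b hb => hv b hb w hw) hΘ 1
        rw [← Algebra.TensorProduct.one_def, one_mul] at this
        rw [this]
        simp
  simpa [Algebra.TensorProduct.tmul_mul_tmul, h1] using key _ hp

theorem hasDerivAt_map_pow (ψ : A →ₗ[ℂ] ℂ) (a b : A) (n : ℕ) (t : ℂ) :
    HasDerivAt (fun t : ℂ => ψ ((t • a + b) ^ n))
      (∑ i ∈ Finset.range n, ψ ((t • a + b) ^ i * a * (t • a + b) ^ (n - 1 - i))) t := by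
  induction n generalizing ψ with
  | zero => simpa using hasDerivAt_const t (ψ 1)
  | succ n ih =>
    have e : (fun t : ℂ => ψ ((t • a + b) ^ (n + 1))) = fun t : ℂ =>
        t * (ψ ∘ₗ LinearMap.mulLeft ℂ a) ((t • a + b) ^ n) +
          (ψ ∘ₗ LinearMap.mulLeft ℂ b) ((t • a + b) ^ n) := by
      funext t
      rw [pow_succ', add_mul, map_add, smul_mul_assoc, map_smul]
      rfl
    rw [e]
    refine (((hasDerivAt_id t).mul (ih (ψ ∘ₗ LinearMap.mulLeft ℂ a))).add
      (ih (ψ ∘ₗ LinearMap.mulLeft ℂ b))).congr_deriv ?_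
    rw [Finset.sum_range_succ', Finset.mul_sum, add_assoc, ← Finset.sum_add_distrib, add_comm]
    simp only [id, LinearMap.comp_apply, LinearMap.mulLeft_apply, pow_zero, one_mul,
      Nat.add_sub_cancel, Nat.sub_zero]
    congr 1
    refine Finset.sum_congr rfl fun i _ => ?_
    have : n - (i + 1) = n - 1 - i := by omega
    rw [this]
    generalize (t • a + b) ^ (n - 1 - i) = Z
    rw [pow_succ', add_mul, add_mul, add_mul, map_add]
    simp only [smul_mul_assoc, map_smul, smul_eq_mul, mul_assoc]

/-- The mechanism of the theorem: the difference quotient of `t s + [s, c] + b` is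
`t 1 ⊗ 1 + 1 ⊗ c - c ⊗ 1`, and the contributions of `c` cancel by traciality. Hence the commutator
does not affect the evolution of the moments in `t`. -/
theorem satisfiesBurgers_of_free {φ : A →ₗ[ℂ] ℂ} (h1 : φ 1 = 1) {s : A} {v : ℂ}
    (hs : ∀ n, φ (s ^ (n + 1)) = v * ∑ d ∈ Finset.range n, φ (s ^ d) * φ (s ^ (n - 1 - d)))
    {D : Subalgebra ℂ A}
    (hv : ∀ a ∈ Algebra.adjoin ℂ {s}, ∀ w, IsReducedWord φ (Algebra.adjoin ℂ {s}) D w →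
      φ (a * w) = 0)
    (htr : ∀ P ∈ Algebra.adjoin ℂ ((Algebra.adjoin ℂ {s} : Set A) ∪ D),
      ∀ Q ∈ Algebra.adjoin ℂ ((Algebra.adjoin ℂ {s} : Set A) ∪ D), φ (P * Q) = φ (Q * P))
    {b c : A} (hb : b ∈ D) (hc : c ∈ D) :
    SatisfiesBurgers v (fun t n => φ ((t • s + (⁅s, c⁆ + b)) ^ n)) := by
  intro n t
  refine (hasDerivAt_map_pow φ s _ n t).congr_deriv ?_
  dsimp only
  set X := t • s + (⁅s, c⁆ + b) with hX
  have hsG : s ∈ Algebra.adjoin ℂ ((Algebra.adjoin ℂ {s} : Set A) ∪ D) :=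
    Algebra.subset_adjoin (Or.inl (Algebra.self_mem_adjoin_singleton ℂ s))
  have hDG : ∀ d ∈ D, d ∈ Algebra.adjoin ℂ ((Algebra.adjoin ℂ {s} : Set A) ∪ D) :=
    fun d hd => Algebra.subset_adjoin (Or.inr hd)
  have hXG : X ∈ Algebra.adjoin ℂ ((Algebra.adjoin ℂ {s} : Set A) ∪ D) :=
    add_mem (Subalgebra.smul_mem _ hsG t) (add_mem (sub_mem (mul_mem hsG (hDG c hc))
      (mul_mem (hDG c hc) hsG)) (hDG b hb))
  -- the lift of `X`
  have hXM : t • quotientMatrix s 1 + (quotientMatrix s 1 * quotientMatrix c 0 -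
      quotientMatrix c 0 * quotientMatrix s 1 + quotientMatrix b 0) =
      quotientMatrix X (t • 1 + (1 ⊗ₜ c - c ⊗ₜ 1)) := by
    simp [quotientMatrix_mul, quotientMatrix_add, quotientMatrix_sub, smul_quotientMatrix, hX,
      Ring.lie_def]
  have hlift : quotientMatrix X (t • 1 + (1 ⊗ₜ c - c ⊗ₜ 1)) ∈ Algebra.adjoin ℂ
      ((Algebra.adjoin ℂ {quotientMatrix s 1} : Set (Matrix (Fin 2) (Fin 2) (A ⊗[ℂ] A))) ∪
        constantSubalgebra D) := by
    have m1 : quotientMatrix s 1 ∈ Algebra.adjoin ℂ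
      ((Algebra.adjoin ℂ {quotientMatrix s 1} : Set (Matrix (Fin 2) (Fin 2) (A ⊗[ℂ] A))) ∪
        constantSubalgebra D) :=
      Algebra.subset_adjoin (Or.inl (Algebra.self_mem_adjoin_singleton ℂ _))
    have m2 : ∀ d ∈ D, quotientMatrix d 0 ∈ Algebra.adjoin ℂ
      ((Algebra.adjoin ℂ {quotientMatrix s 1} : Set (Matrix (Fin 2) (Fin 2) (A ⊗[ℂ] A))) ∪
        constantSubalgebra D) := fun d hd =>
      Algebra.subset_adjoin (Or.inr ⟨d, hd, rfl⟩)
    rw [← hXM]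
    exact add_mem (Subalgebra.smul_mem _ m1 t) (add_mem (sub_mem (mul_mem m1 (m2 c hc))
      (mul_mem (m2 c hc) m1)) (m2 b hb))
  have hcyc : ∀ i ∈ Finset.range n, φ (X ^ i * s * X ^ (n - 1 - i)) = φ (s * X ^ (n - 1)) := by
    intro i hi
    rw [Finset.mem_range] at hi
    rw [mul_assoc, htr _ (pow_mem hXG i) _ (mul_mem hsG (pow_mem hXG _)), mul_assoc, ← pow_add]
    congr 3
    omega
  rw [Finset.sum_congr rfl hcyc, Finset.sum_const, Finset.card_range, nsmul_eq_mul,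
    schwinger_dyson h1 hs hv (quotientMatrix_pow X _ (n - 1) ▸ pow_mem hlift (n - 1)), map_sum]
  have e : ∀ d, tensorSq φ ((X ^ d) ⊗ₜ 1 * (t • 1 + (1 ⊗ₜ c - c ⊗ₜ 1)) *
      1 ⊗ₜ (X ^ (n - 1 - 1 - d))) = t * (φ (X ^ d) * φ (X ^ (n - 1 - 1 - d))) +
        (φ (X ^ d) * φ (c * X ^ (n - 1 - 1 - d)) - φ (c * X ^ d) * φ (X ^ (n - 1 - 1 - d))) := by
    intro d
    rw [htr c (hDG c hc) _ (pow_mem hXG d)]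
    simp [mul_add, add_mul, mul_sub, sub_mul, Algebra.TensorProduct.one_def,
      Algebra.TensorProduct.tmul_mul_tmul]
  simp only [e]
  have cancel : ∑ d ∈ Finset.range (n - 1), φ (X ^ d) * φ (c * X ^ (n - 1 - 1 - d)) =
      ∑ d ∈ Finset.range (n - 1), φ (c * X ^ d) * φ (X ^ (n - 1 - 1 - d)) := by
    rw [← Finset.sum_range_reflect]
    refine Finset.sum_congr rfl fun d hd => ?_
    rw [Finset.mem_range] at hd
    have : n - 1 - 1 - (n - 1 - 1 - d) = d := by omega
    rw [this, mul_comm]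
  rw [Finset.sum_add_distrib, Finset.sum_sub_distrib, cancel, sub_self, add_zero,
    ← Finset.mul_sum]
  simp only [Nat.sub_sub]
  ring

end SchwingerDyson

/-! ### Moments of the semicircle law -/

section Semicircle

theorem sum_range_two_mul_add_one {f : ℕ → ℂ} (hf : ∀ k, f (2 * k + 1) = 0) (n : ℕ) :
    ∑ d ∈ Finset.range (2 * n + 1), f d = ∑ k ∈ Finset.range (n + 1), f (2 * k) := by
  induction n with
  | zero => simp
  | succ n ih =>
    rw [show 2 * (n + 1) + 1 = 2 * n + 1 + 1 + 1 by ring, Finset.sum_range_succ,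
      Finset.sum_range_succ, ih, hf, add_zero, Finset.sum_range_succ _ (n + 1)]
    rfl

/-- The recursion of the Catalan numbers as the Schwinger-Dyson equation of the semicircle law. -/
theorem semicircle_recursion {m : ℕ → ℂ} {σ : ℂ}
    (h : ∀ k, m (2 * k) = σ ^ (2 * k) * (catalan k : ℂ) ∧ m (2 * k + 1) = 0) (n : ℕ) :
    m (n + 1) = σ ^ 2 * ∑ d ∈ Finset.range n, m d * m (n - 1 - d) := by
  obtain ⟨k, rfl | rfl⟩ := Nat.even_or_odd' n
  · rw [(h k).2, Finset.sum_eq_zero, mul_zero]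
    intro d hd
    rw [Finset.mem_range] at hd
    obtain ⟨e, rfl | rfl⟩ := Nat.even_or_odd' d
    · rw [show 2 * k - 1 - 2 * e = 2 * (k - 1 - e) + 1 by omega, (h _).2, mul_zero]
    · rw [(h e).2, zero_mul]
  · rw [sum_range_two_mul_add_one (fun j => by rw [(h j).2, zero_mul]),
      show 2 * k + 1 + 1 = 2 * (k + 1) by ring, (h _).1, catalan_succ',
      Finset.Nat.sum_antidiagonal_eq_sum_range_succ_mk]
    push_cast
    rw [Finset.mul_sum, Finset.mul_sum]
    refine Finset.sum_congr rfl fun j hj => ?_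
    rw [Finset.mem_range] at hj
    rw [show 2 * k - 2 * j = 2 * (k - j) by omega, (h _).1, (h _).1]
    have : σ ^ (2 * (k + 1)) = σ ^ 2 * σ ^ (2 * j) * σ ^ (2 * (k - j)) := by
      rw [← pow_add, ← pow_add]
      congr 1
      omega
    rw [this]
    ring

end Semicircle

/-! ### Distributions of self-adjoint elements -/

section Distribution

open scoped ComplexOrder CompactlySupported

variable {A : Type*} [CStarAlgebra A]

theorem IsFaithfulTracialState.map_eq_re {τ : A →ₗ[ℂ] ℂ} (hτ : IsFaithfulTracialState τ) {a : A}
    (ha : IsSelfAdjoint a) : τ a = ((τ a).re : ℂ) := by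
  -- expand the positive number `τ ((1 + a)* (1 + a))`
  have h1 := hτ.nonneg (1 + a)
  have h2 := hτ.nonneg a
  have e : star (1 + a) * (1 + a) = 1 + (2 : ℂ) • a + star a * a := by
    rw [star_add, star_one, ha.star_eq, two_smul]
    noncomm_ring
  rw [e, map_add, map_add, map_smul, hτ.map_one] at h1
  have i1 := (Complex.le_def.mp h1).2
  have i2 := (Complex.le_def.mp h2).2
  simp only [Complex.zero_im, Complex.add_im, Complex.one_im, smul_eq_mul, Complex.mul_im,
    Complex.re_ofNat, Complex.im_ofNat] at i1 i2
  apply Complex.ext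
  · simp
  · simp only [Complex.ofReal_im]
    linarith

/-- The state on continuous functions on the spectrum of `a` given by the continuous functional
calculus. -/
noncomputable def spectralFunctional (τ : A →ₗ[ℂ] ℂ) (hτ : IsFaithfulTracialState τ) {a : A}
    (ha : IsSelfAdjoint a) : C_c(spectrum ℝ a, ℝ) →ₚ[ℝ] ℝ :=
  PositiveLinearMap.mk₀
    { toFun := fun f => (τ (cfcHom (R := ℝ) ha (f : C(spectrum ℝ a, ℝ)))).re
      map_add' := fun f g => by
        have : ((f + g : C_c(spectrum ℝ a, ℝ)) : C(spectrum ℝ a, ℝ)) =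
            (f : C(spectrum ℝ a, ℝ)) + (g : C(spectrum ℝ a, ℝ)) := rfl
        rw [this, map_add, map_add, Complex.add_re]
      map_smul' := fun r f => by
        have : ((r • f : C_c(spectrum ℝ a, ℝ)) : C(spectrum ℝ a, ℝ)) =
            r • (f : C(spectrum ℝ a, ℝ)) := rfl
        rw [this, map_smul, ← Complex.coe_smul, map_smul]
        simp }
    (fun f hf => by
      set g : C(spectrum ℝ a, ℝ) := ⟨fun t => Real.sqrt (f t), by fun_prop⟩ with hg
      have e : (f : C(spectrum ℝ a, ℝ)) = star g * g := by
        ext t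
        have : 0 ≤ f t := hf t
        simp [hg, Real.mul_self_sqrt this]
      change 0 ≤ (τ (cfcHom (R := ℝ) ha (f : C(spectrum ℝ a, ℝ)))).re
      rw [e, map_mul, map_star]
      exact (Complex.le_def.mp (hτ.nonneg _)).1)

/-- Every self-adjoint element has a distribution, by the Riesz representation theorem on its
spectrum. -/
theorem IsFaithfulTracialState.exists_isDistribution {τ : A →ₗ[ℂ] ℂ}
    (hτ : IsFaithfulTracialState τ) {a : A} (ha : IsSelfAdjoint a) :
    ∃ μ : Measure ℝ, IsDistribution τ a μ := by
  set Λ := spectralFunctional τ hτ ha with hΛ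
  set ν := RealRMK.rieszMeasure Λ with hν
  have hint : ∀ f : C(spectrum ℝ a, ℝ), ∫ t, f t ∂ν = (τ (cfcHom (R := ℝ) ha f)).re := fun f =>
    RealRMK.integral_rieszMeasure Λ (CompactlySupportedContinuousMap.continuousMapEquiv f)
  have hpow : ∀ n : ℕ, ∫ t : spectrum ℝ a, (t : ℝ) ^ n ∂ν = (τ (a ^ n)).re := by
    intro n
    have := hint ((ContinuousMap.restrict (spectrum ℝ a) (ContinuousMap.id ℝ)) ^ n)
    rw [map_pow, cfcHom_id] at this
    exact this
  have hprob : IsProbabilityMeasure ν := by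
    have := hpow 0
    simp only [pow_zero, hτ.map_one, Complex.one_re, integral_const, smul_eq_mul, mul_one,
      Measure.real] at this
    exact ⟨(ENNReal.toReal_eq_one_iff _).mp this⟩
  have hemb : MeasurableEmbedding (Subtype.val : spectrum ℝ a → ℝ) :=
    MeasurableEmbedding.subtype_coe (spectrum.isCompact (𝕜 := ℝ) a).measurableSet
  refine ⟨ν.map Subtype.val, ha, ⟨Measure.isProbabilityMeasure_map hemb.measurable.aemeasurable,
    spectrum ℝ a, spectrum.isCompact a, ?_⟩, fun n => ?_⟩
  · rw [hemb.map_apply]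
    simp
  · rw [hemb.integral_map, hpow, ← hτ.map_eq_re (ha.pow n)]

end Distribution

/-! ### Cumulants of low order -/

section LowOrder

theorem cumulant_restrict {α R : Type*} [CommRing R] (M : (n : ℕ) → (Fin n → α) → R) {n : ℕ}
    (a : Fin n → α) (V : Finset (Fin n)) {m : ℕ} (h : V.card = m) :
    cumulant M V.card (restrict a V) = cumulant M m (fun k => a (V.orderEmbOfFin h k)) := by
  subst h
  rfl

variable {A : Type*} [Ring A] [Algebra ℂ A]

theorem freeCumulant_fin_one (φ : A →ₗ[ℂ] ℂ) (a : Fin 1 → A) : freeCumulant φ a = φ (a 0) := by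
  rw [freeCumulant, cumulant_eq_sub, Finset.sum_eq_zero, sub_zero]
  · simp
  · intro π hπ
    obtain ⟨V, hV, h0⟩ := π.exists_mem (Finset.mem_univ (0 : Fin 1))
    have := card_lt_of_mem_parts (Finset.mem_filter.mp hπ).2 hV
    have := Finset.card_pos.mpr ⟨0, h0⟩
    omega

theorem cumulant_restrict_singleton (φ : A →ₗ[ℂ] ℂ) {n : ℕ} (a : Fin n → A) (i : Fin n) :
    cumulant (fun m b => φ (List.ofFn (n := m) b).prod) ({i} : Finset (Fin n)).card
      (restrict a {i}) = φ (a i) := by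
  rw [cumulant_restrict _ a {i} (Finset.card_singleton i)]
  refine (freeCumulant_fin_one φ _).trans ?_
  simp

theorem freeCumulant_fin_two (φ : A →ₗ[ℂ] ℂ) (a : Fin 2 → A) :
    freeCumulant φ a = φ (a 0 * a 1) - φ (a 0) * φ (a 1) := by
  classical
  have hNC : (NC 2).filter (fun π => Finset.univ ∉ π.parts) = {⊥} := by
    ext π
    rw [Finset.mem_filter, Finset.mem_singleton]
    constructor
    · rintro ⟨-, h⟩
      rw [eq_bot_iff]
      intro V hV
      have h1 := card_lt_of_mem_parts h hV
      have h2 := Finset.card_pos.mpr (π.nonempty_of_mem_parts hV)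
      obtain ⟨i, rfl⟩ := Finset.card_eq_one.mp (show V.card = 1 by omega)
      exact ⟨{i}, by simp, le_rfl⟩
    · rintro rfl
      refine ⟨Finset.mem_filter.mpr ⟨Finset.mem_univ _, ?_⟩, ?_⟩
      · intro V _ W _ i _ j _ k _ l _ hij hjk
        omega
      · intro h
        obtain ⟨i, -, hi⟩ := Finpartition.mem_bot_iff.mp h
        have := congrArg Finset.card hi
        simp at this
  rw [freeCumulant, cumulant_eq_sub, hNC, Finset.sum_singleton, Finpartition.parts_bot,
    Finset.prod_map]
  simp only [Function.Embedding.coeFn_mk, cumulant_restrict_singleton, Fin.prod_univ_two]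
  simp

theorem freeCumulant₁_two (φ : A →ₗ[ℂ] ℂ) (a : A) :
    freeCumulant₁ φ 2 a = φ (a * a) - φ a ^ 2 := by
  rw [freeCumulant₁, freeCumulant_fin_two, sq]

theorem cumulant_restrict_pair (φ : A →ₗ[ℂ] ℂ) {n : ℕ} (a : Fin n → A) {i j : Fin n}
    (hij : i < j) :
    cumulant (fun m b => φ (List.ofFn (n := m) b).prod) ({i, j} : Finset (Fin n)).card
      (restrict a {i, j}) = φ (a i * a j) - φ (a i) * φ (a j) := by
  have hc := Finset.card_pair hij.ne
  have hmono : StrictMono (![i, j] : Fin 2 → Fin n) := by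
    rw [Fin.strictMono_iff_lt_succ]
    intro k
    fin_cases k
    simpa using hij
  have := Finset.orderEmbOfFin_unique hc (f := ![i, j])
    (fun k => by fin_cases k <;> simp) hmono
  rw [cumulant_restrict _ a {i, j} hc, ← this]
  exact freeCumulant_fin_two φ _

/-- For centered variables with `φ(a₀ a₁) = 0`, the partition `{{0, 3}, {1, 2}}` is the only one
with several blocks that contributes to the fourth moment. -/
theorem freeCumulant_fin_four (φ : A →ₗ[ℂ] ℂ) (a : Fin 4 → A) (h0 : ∀ i, φ (a i) = 0)
    (h01 : φ (a 0 * a 1) = 0) :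
    freeCumulant φ a = φ (a 0 * a 1 * a 2 * a 3) - φ (a 0 * a 3) * φ (a 1 * a 2) := by
  classical
  set π₀ : Finpartition (Finset.univ : Finset (Fin 4)) :=
    Finpartition.ofExistsUnique {{0, 3}, {1, 2}} (by decide) (by
      intro i _
      fin_cases i
      · exact ⟨{0, 3}, by decide, by simp +decide⟩
      · exact ⟨{1, 2}, by decide, by simp +decide⟩
      · exact ⟨{1, 2}, by decide, by simp +decide⟩
      · exact ⟨{0, 3}, by decide, by simp +decide⟩) (by decide) with hπ₀
  have hparts : π₀.parts = {{0, 3}, {1, 2}} := rfl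
  have hmem : π₀ ∈ (NC 4).filter (fun π => Finset.univ ∉ π.parts) := by
    refine Finset.mem_filter.mpr ⟨Finset.mem_filter.mpr ⟨Finset.mem_univ _, ?_⟩, ?_⟩
    · intro V hV W hW
      rw [hparts, Finset.mem_insert, Finset.mem_singleton] at hV hW
      rcases hV with rfl | rfl <;> rcases hW with rfl | rfl <;> decide
    · rw [hparts]
      decide
  rw [freeCumulant, cumulant_eq_sub, Finset.sum_eq_single_of_mem π₀ hmem]
  · rw [hparts, Finset.prod_pair (by decide),
      cumulant_restrict_pair φ a (show (0 : Fin 4) < 3 by decide),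
      cumulant_restrict_pair φ a (show (1 : Fin 4) < 2 by decide)]
    simp [h0, List.ofFn_succ, mul_assoc]
  · intro π hπ hne
    rw [Finset.mem_filter] at hπ
    obtain ⟨hπ, hu⟩ := hπ
    have hnc : IsNoncrossing π := (Finset.mem_filter.mp hπ).2
    by_contra hprod
    have hnz := Finset.prod_ne_zero_iff.mp hprod
    have hs : ∀ i, {i} ∉ π.parts := fun i hi =>
      hnz _ hi (by rw [cumulant_restrict_singleton, h0])
    have hp : {0, 1} ∉ π.parts := fun hi =>
      hnz _ hi (by rw [cumulant_restrict_pair φ a (by decide), h01, h0, zero_mul, sub_zero])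
    obtain ⟨V, hV, hV0⟩ := π.exists_mem (Finset.mem_univ (0 : Fin 4))
    have hcases : ∀ V : Finset (Fin 4), 0 ∈ V → V = Finset.univ ∨ V = {0} ∨ V = {0, 1} ∨
        V = {0, 2} ∨ V = {0, 3} ∨ V = {0, 1, 2} ∨ V = {0, 1, 3} ∨ V = {0, 2, 3} := by decide
    have hblock : ∀ i j, ∀ W ∈ π.parts, i ∈ W → j ∈ V → i ∉ V → j ∉ W := by
      intro i j W hW hi hj hi' hj'
      rw [π.eq_of_mem_parts hV hW hj hj'] at hi'
      exact hi' hi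
    rcases hcases V hV0 with rfl | rfl | rfl | rfl | rfl | rfl | rfl | rfl
    · exact hu hV
    · exact hs 0 hV
    · exact hp hV
    · obtain ⟨W, hW, hW1⟩ := π.exists_mem (Finset.mem_univ (1 : Fin 4))
      have e0 := hblock 1 0 W hW hW1 (by decide) (by decide)
      have e2 := hblock 1 2 W hW hW1 (by decide) (by decide)
      have hW' : ∀ W : Finset (Fin 4), 1 ∈ W → 0 ∉ W → 2 ∉ W → W = {1} ∨ 3 ∈ W := by decide
      rcases hW' W hW1 e0 e2 with rfl | h3
      · exact hs 1 hW
      · have := hnc _ hV W hW 0 (by decide) 1 hW1 2 (by decide) 3 h3 (by decide) (by decide)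
          (by decide)
        rw [← this] at e0
        exact e0 (by decide)
    · obtain ⟨W, hW, hW1⟩ := π.exists_mem (Finset.mem_univ (1 : Fin 4))
      have e0 := hblock 1 0 W hW hW1 (by decide) (by decide)
      have e3 := hblock 1 3 W hW hW1 (by decide) (by decide)
      have hW' : ∀ W : Finset (Fin 4), 1 ∈ W → 0 ∉ W → 3 ∉ W → W = {1} ∨ W = {1, 2} := by decide
      rcases hW' W hW1 e0 e3 with rfl | rfl
      · exact hs 1 hW
      · refine hne (Finpartition.ext ?_)
        rw [hparts]
        ext U
        rw [Finset.mem_insert, Finset.mem_singleton]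
        constructor
        · intro hU
          obtain ⟨i, hi⟩ := π.nonempty_of_mem_parts hU
          have : i ∈ ({0, 3} : Finset (Fin 4)) ∨ i ∈ ({1, 2} : Finset (Fin 4)) := by
            clear hi
            decide +revert
          exact this.imp (π.eq_of_mem_parts hU hV hi) (π.eq_of_mem_parts hU hW hi)
        · rintro (rfl | rfl) <;> assumption
    · obtain ⟨W, hW, hW3⟩ := π.exists_mem (Finset.mem_univ (3 : Fin 4))
      have hW' : ∀ W : Finset (Fin 4), 3 ∈ W → 0 ∉ W → 1 ∉ W → 2 ∉ W → W = {3} := by decide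
      obtain rfl := hW' W hW3 (hblock 3 0 W hW hW3 (by decide) (by decide))
        (hblock 3 1 W hW hW3 (by decide) (by decide)) (hblock 3 2 W hW hW3 (by decide) (by decide))
      exact hs 3 hW
    · obtain ⟨W, hW, hW2⟩ := π.exists_mem (Finset.mem_univ (2 : Fin 4))
      have hW' : ∀ W : Finset (Fin 4), 2 ∈ W → 0 ∉ W → 1 ∉ W → 3 ∉ W → W = {2} := by decide
      obtain rfl := hW' W hW2 (hblock 2 0 W hW hW2 (by decide) (by decide))
        (hblock 2 1 W hW hW2 (by decide) (by decide)) (hblock 2 3 W hW hW2 (by decide) (by decide))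
      exact hs 2 hW
    · obtain ⟨W, hW, hW1⟩ := π.exists_mem (Finset.mem_univ (1 : Fin 4))
      have hW' : ∀ W : Finset (Fin 4), 1 ∈ W → 0 ∉ W → 2 ∉ W → 3 ∉ W → W = {1} := by decide
      obtain rfl := hW' W hW1 (hblock 1 0 W hW hW1 (by decide) (by decide))
        (hblock 1 2 W hW hW1 (by decide) (by decide)) (hblock 1 3 W hW hW1 (by decide) (by decide))
      exact hs 1 hW

theorem freeCumulant₁_zero (φ : A →ₗ[ℂ] ℂ) (n : ℕ) (hn : 1 ≤ n) :
    freeCumulant₁ φ n (0 : A) = 0 := by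
  refine freeCumulant₁_eq φ 0 (fun _ => 0) (fun k hk => ?_) n hn
  rw [zero_pow (by omega), map_zero, Finset.sum_eq_zero]
  intro π _
  obtain ⟨V, hV, -⟩ := π.exists_mem (Finset.mem_univ (⟨0, hk⟩ : Fin k))
  exact Finset.prod_eq_zero hV rfl

end LowOrder

/-! ### Mixed moments of free elements -/

section FreeMoments

variable {A : Type*} [Ring A] [Algebra ℂ A] {φ : A →ₗ[ℂ] ℂ} {a b : A}

theorem Free.map_mul_reducedWord (h1 : φ 1 = 1) (h : Free φ a b) {p w : A}
    (hp : p ∈ Algebra.adjoin ℂ {a})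
    (hw : IsReducedWord φ (Algebra.adjoin ℂ {a}) (Algebra.adjoin ℂ {b}) w) : φ (p * w) = 0 :=
  FreeSubalgebras.map_mul_reducedWord h h1 (i := true) (j := false) (by simp) hp hw

theorem Free.map_mul (h1 : φ 1 = 1) (h : Free φ a b) {p q : A} (hp : p ∈ Algebra.adjoin ℂ {a})
    (hq : q ∈ Algebra.adjoin ℂ {b}) : φ (p * q) = φ p * φ q := by
  have := h.map_mul_reducedWord h1 hp
    (.single (sub_algebraMap_mem hq _) (map_sub_algebraMap h1 q) (one_mem _))
  rw [mul_one, mul_sub, map_sub, sub_eq_zero, ← Algebra.commutes, ← Algebra.smul_def,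
    map_smul, smul_eq_mul, mul_comm (φ q)] at this
  exact this

theorem Free.map_mul_mul_mul (h1 : φ 1 = 1) (h : Free φ a b) {p r q : A}
    (hp : p ∈ Algebra.adjoin ℂ {a}) (hr : r ∈ Algebra.adjoin ℂ {a})
    (hq : q ∈ Algebra.adjoin ℂ {b}) (hq0 : φ q = 0) :
    φ (p * (q * (r * q))) = φ p * φ r * φ (q * q) := by
  have := h.map_mul_reducedWord h1 hp (.cons hq hq0 (sub_algebraMap_mem hr (φ r))
    (map_sub_algebraMap h1 r) (.single hq hq0 (one_mem _)))
  rw [mul_one, sub_mul, mul_sub, mul_sub, map_sub, sub_eq_zero, ← Algebra.smul_def,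
    mul_smul_comm, mul_smul_comm, map_smul, h.map_mul h1 hp (mul_mem hq hq), smul_eq_mul] at this
  rw [this]
  ring

end FreeMoments

/-! ### Moments of the commutator -/

section Commutator

variable {A : Type*} [Ring A] [Algebra ℂ A]

theorem smul_lie_eq (c : ℂ) (s x : A) : c • ⁅s, x⁆ = ⁅s, c • x⁆ := by
  rw [Ring.lie_def, Ring.lie_def, smul_sub, mul_smul_comm, smul_mul_assoc]

theorem lie_sub_algebraMap (s x : A) (c : ℂ) : ⁅s, x - algebraMap ℂ A c⁆ = ⁅s, x⁆ := by
  rw [Ring.lie_def, Ring.lie_def, mul_sub, sub_mul, Algebra.commutes]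
  abel

theorem map_centered_sq {φ : A →ₗ[ℂ] ℂ} (h1 : φ 1 = 1) (x : A) :
    φ ((x - algebraMap ℂ A (φ x)) * (x - algebraMap ℂ A (φ x))) = freeCumulant₁ φ 2 x := by
  rw [mul_sub, map_sub, ← Algebra.commutes, ← Algebra.smul_def, map_smul,
    map_sub_algebraMap h1, smul_zero, sub_zero, sub_mul, ← Algebra.smul_def, map_sub, map_smul,
    freeCumulant₁_two, smul_eq_mul, sq]

variable {φ : A →ₗ[ℂ] ℂ} {s d : A}

theorem commutator_moments (h1 : φ 1 = 1) (htr : ∀ a b, φ (a * b) = φ (b * a))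
    (hfree : ∀ p ∈ Algebra.adjoin ℂ {s}, ∀ r ∈ Algebra.adjoin ℂ {s},
      φ (p * (d * (r * d))) = φ p * φ r * φ (d * d))
    (hm1 : φ s = 0) :
    φ ((Complex.I • ⁅s, d⁆) * (Complex.I • ⁅s, d⁆)) = 2 * φ (s * s) * φ (d * d) ∧
    φ (s * (Complex.I • ⁅s, d⁆) * (Complex.I • ⁅s, d⁆) * s) =
      (φ (s * s * s * s) + φ (s * s) ^ 2) * φ (d * d) := by
  have hs := Algebra.self_mem_adjoin_singleton ℂ s
  have m0 := one_mem (Algebra.adjoin ℂ {s})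
  have sq : (Complex.I • ⁅s, d⁆) * (Complex.I • ⁅s, d⁆) = -(⁅s, d⁆ * ⁅s, d⁆) := by
    rw [smul_mul_smul_comm, Complex.I_mul_I, neg_one_smul]
  -- the reduced moments, after moving a trailing `s` to the front
  have f1 := hfree s hs s hs
  have f2 := hfree (s * s) (mul_mem hs hs) 1 m0
  have f3 := hfree 1 m0 (s * s) (mul_mem hs hs)
  have f4 := hfree (s * s * s) (mul_mem (mul_mem hs hs) hs) s hs
  have f5 := hfree (s * s * s * s) (mul_mem (mul_mem (mul_mem hs hs) hs) hs) 1 m0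
  have f6 := hfree (s * s) (mul_mem hs hs) (s * s) (mul_mem hs hs)
  have t1 := htr (d * s * d) s
  have t2 := htr (s * d * d) s
  have t3 := htr (s * s * s * d * d) s
  have t4 := htr (s * s * d * s * d) s
  simp only [mul_assoc, one_mul, h1, hm1, zero_mul, mul_zero] at f1 f2 f3 f4 f5 f6 t1 t2 t3 t4
  constructor
  · rw [sq, Ring.lie_def]
    have e : -((s * d - d * s) * (s * d - d * s)) =
        -(s * (d * (s * d))) + s * (d * (d * s)) + d * (s * (s * d)) - d * (s * (d * s)) := by
      noncomm_ring
    rw [e, map_sub, map_add, map_add, map_neg, t1, t2, f1, f2, f3]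
    ring
  · rw [htr, mul_assoc s, sq, Ring.lie_def]
    have e : s * (s * -((s * d - d * s) * (s * d - d * s))) =
        -(s * (s * (s * (d * (s * d))))) + s * (s * (s * (d * (d * s)))) +
          s * (s * (d * (s * (s * d)))) - s * (s * (d * (s * (d * s)))) := by
      noncomm_ring
    rw [e, map_sub, map_add, map_add, map_neg, t3, t4, f4, f5, f6]
    simp only [mul_assoc]
    ring

end Commutator

/-! ### The commutator in a tracial C*-probability space -/

section Main

variable {A : Type*} [CStarAlgebra A] {τ : A →ₗ[ℂ] ℂ} {s x : A}

theorem isSelfAdjoint_I_smul_lie (hs : IsSelfAdjoint s) (hx : IsSelfAdjoint x) :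
    IsSelfAdjoint (Complex.I • ⁅s, x⁆) := by
  rw [isSelfAdjoint_iff, star_smul, Ring.lie_def, star_sub, star_mul, star_mul, hs.star_eq,
    hx.star_eq, Complex.star_def, Complex.conj_I, neg_smul, ← smul_neg, neg_sub]

theorem IsFaithfulTracialState.eq_algebraMap_of_freeCumulant₁_two
    (hτ : IsFaithfulTracialState τ) (hx : IsSelfAdjoint x) (h : freeCumulant₁ τ 2 x = 0) :
    x = algebraMap ℂ A (τ x) := by
  have hsa : star (x - algebraMap ℂ A (τ x)) = x - algebraMap ℂ A (τ x) := by
    have : star (τ x) = τ x := by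
      rw [hτ.map_eq_re hx]
      exact Complex.conj_ofReal _
    rw [star_sub, hx.star_eq, ← algebraMap_star_comm, this]
  rw [← map_centered_sq hτ.map_one] at h
  exact sub_eq_zero.mp (hτ.faithful _ (by rw [hsa, h]))

theorem IsDistribution.measureCumulant_eq {μ : Measure ℝ} (h : IsDistribution τ x μ) (n : ℕ)
    (hn : 1 ≤ n) : (measureCumulant μ n : ℂ) = freeCumulant₁ τ n x :=
  FreeProb.measureCumulant_eq μ (fun k => freeCumulant₁ τ k x)
    (fun k hk => by rw [← h.2.2 k, moment_eq_sum_freeCumulant₁ τ x k hk]) n hn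

/-- The fourth mixed cumulant of `s` and the commutator in terms of moments. -/
theorem freeCumulant_commutator (htr : ∀ a b, τ (a * b) = τ (b * a))
    (hs0 : τ s = 0) :
    freeCumulant τ ![s, Complex.I • ⁅s, x⁆, Complex.I • ⁅s, x⁆, s] =
      τ (s * (Complex.I • ⁅s, x⁆) * (Complex.I • ⁅s, x⁆) * s) -
        τ (s * s) * τ ((Complex.I • ⁅s, x⁆) * (Complex.I • ⁅s, x⁆)) := by
  have hy0 : τ (Complex.I • ⁅s, x⁆) = 0 := by
    rw [map_smul, Ring.lie_def, map_sub, htr, sub_self, smul_zero]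
  have hsy : τ (s * (Complex.I • ⁅s, x⁆)) = 0 := by
    rw [mul_smul_comm, map_smul, Ring.lie_def, mul_sub, map_sub, htr s (x * s), mul_assoc,
      htr x, mul_assoc, sub_self, smul_zero]
  rw [freeCumulant_fin_four]
  · rfl
  · intro i
    fin_cases i
    exacts [hs0, hy0, hy0, hs0]
  · exact hsy

end Main

end FreeProb

theorem theorem1p1 {A : Type u} [CStarAlgebra A] (τ : A →ₗ[ℂ] ℂ)
    (hτ : FreeProb.IsFaithfulTracialState τ) (s x : A)
    (hs : FreeProb.IsSemicircular τ s) (hfree : FreeProb.Free τ s x) :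
    -- free cumulants are additive
    (∀ n : ℕ, 1 ≤ n →
      FreeProb.freeCumulant₁ τ n (s + Complex.I • ⁅s, x⁆) =
        FreeProb.freeCumulant₁ τ n s + FreeProb.freeCumulant₁ τ n (Complex.I • ⁅s, x⁆)) ∧
    -- `s + i[s,x]` has the moments of the sum of any free copies of `s` and `i[s,x]`
    (∀ (B : Type v) [Ring B] [Algebra ℂ B] (φ : B →ₗ[ℂ] ℂ) (a b : B), φ 1 = 1 →
      FreeProb.Free φ a b →
      (∀ n : ℕ, φ (a ^ n) = τ (s ^ n)) →
      (∀ n : ℕ, φ (b ^ n) = τ ((Complex.I • ⁅s, x⁆) ^ n)) →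
      ∀ n : ℕ, φ ((a + b) ^ n) = τ ((s + Complex.I • ⁅s, x⁆) ^ n)) ∧
    -- for self-adjoint `x`, the distributions are measures and satisfy the convolution identity
    (IsSelfAdjoint x → ∃ μ ν ρ : MeasureTheory.Measure ℝ,
      FreeProb.IsDistribution τ s μ ∧
      FreeProb.IsDistribution τ (Complex.I • ⁅s, x⁆) ν ∧
      FreeProb.IsDistribution τ (s + Complex.I • ⁅s, x⁆) ρ ∧
      FreeProb.IsFreeConvolution μ ν ρ) ∧
    -- the mixed cumulant
    FreeProb.freeCumulant τ ![s, Complex.I • ⁅s, x⁆, Complex.I • ⁅s, x⁆, s] =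
      FreeProb.freeCumulant₁ τ 2 s ^ 2 * FreeProb.freeCumulant₁ τ 2 x ∧
    -- absence of freeness
    (FreeProb.freeCumulant₁ τ 2 x ≠ 0 →
      FreeProb.freeCumulant τ ![s, Complex.I • ⁅s, x⁆, Complex.I • ⁅s, x⁆, s] ≠ 0 ∧
      ¬ FreeProb.Free τ s (Complex.I • ⁅s, x⁆)) ∧
    -- the condition `κ₂(x) ≠ 0` holds for every self-adjoint `x` that is not a scalar
    (IsSelfAdjoint x → (∀ c : ℂ, x ≠ algebraMap ℂ A c) →
      FreeProb.freeCumulant₁ τ 2 x ≠ 0) := by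
  open FreeProb in
  obtain ⟨hsa, σ, hσ, hmom⟩ := hs
  have h1 := hτ.map_one
  have htr := hτ.tracial
  have hrec := semicircle_recursion (m := fun n => τ (s ^ n)) hmom
  have hy : Complex.I • ⁅s, x⁆ = ⁅s, Complex.I • x⁆ := smul_lie_eq _ _ _
  have hv : ∀ a ∈ Algebra.adjoin ℂ {s}, ∀ w,
      IsReducedWord τ (Algebra.adjoin ℂ {s}) (Algebra.adjoin ℂ {x}) w → τ (a * w) = 0 :=
    fun a ha w hw => hfree.map_mul_reducedWord h1 ha hw
  have hxD := Algebra.self_mem_adjoin_singleton ℂ x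
  -- the moments of `t s + i[s,x]` and of `t s`
  have burgers : ∀ c ∈ Algebra.adjoin ℂ {x},
      SatisfiesBurgers ((σ : ℂ) ^ 2) (fun t n => τ ((t • s + ⁅s, c⁆) ^ n)) := fun c hc => by
    simpa using satisfiesBurgers_of_free h1 hrec hv (fun P _ Q _ => htr P Q) (zero_mem _) hc
  have hB := burgers (Complex.I • x) (Subalgebra.smul_mem _ hxD _)
  rw [← hy] at hB
  have hκX := hB.freeCumulant₁_eq h1 (X := s + Complex.I • ⁅s, x⁆) (y := Complex.I • ⁅s, x⁆)
    (by simp) (by simp)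
  have hκs := (burgers 0 (zero_mem _)).freeCumulant₁_eq h1 (X := s) (y := 0)
    (by simp [Ring.lie_def]) (by simp [Ring.lie_def])
  have hadd : ∀ n : ℕ, 1 ≤ n → freeCumulant₁ τ n (s + Complex.I • ⁅s, x⁆) =
      freeCumulant₁ τ n s + freeCumulant₁ τ n (Complex.I • ⁅s, x⁆) := fun n hn => by
    rw [hκX n hn, hκs n hn, freeCumulant₁_zero τ n hn, zero_add, add_comm]
  -- the low moments of `s`
  have hm1 : τ s = 0 := by simpa using (hmom 0).2
  have hm2 : τ (s * s) = (σ : ℂ) ^ 2 := by simpa [pow_succ] using (hmom 1).1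
  have hm4 : τ (s * s * s * s) = (σ : ℂ) ^ 4 * 2 := by
    simpa [pow_succ, catalan_two] using (hmom 2).1
  have hκ2 : freeCumulant₁ τ 2 s = (σ : ℂ) ^ 2 := by
    rw [freeCumulant₁_two, hm1, hm2]
    simp
  have hcom := commutator_moments h1 htr (d := x - algebraMap ℂ A (τ x))
    (fun p hp r hr => hfree.map_mul_mul_mul h1 hp hr (sub_algebraMap_mem hxD _)
      (map_sub_algebraMap h1 x)) hm1
  rw [lie_sub_algebraMap, map_centered_sq h1, hm2, hm4] at hcom
  have hκ4 := freeCumulant_commutator (x := x) htr hm1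
  have hmixed : freeCumulant τ ![s, Complex.I • ⁅s, x⁆, Complex.I • ⁅s, x⁆, s] =
      freeCumulant₁ τ 2 s ^ 2 * freeCumulant₁ τ 2 x := by
    rw [hκ4, hcom.1, hcom.2, hm2, hκ2]
    ring
  refine ⟨hadd, ?_, ?_, hmixed, ?_, ?_⟩
  · intro B _ _ φ a b hφ hab ha hb n
    have hBB := satisfiesBurgers_of_free hφ (s := a) (v := (σ : ℂ) ^ 2)
      (fun n => by simpa only [ha] using hrec n)
      (fun p hp w hw => hab.map_mul_reducedWord hφ hp hw)
      (fun P hP Q hQ => hab.map_mul_comm hφ hP hQ)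
      (Algebra.self_mem_adjoin_singleton ℂ b) (zero_mem _)
    have := hBB.unique hB (fun n => by simpa [Ring.lie_def] using hb n) 1 n
    simpa [Ring.lie_def] using this
  · intro hx
    have hya := isSelfAdjoint_I_smul_lie hsa hx
    obtain ⟨μ, hμ⟩ := hτ.exists_isDistribution hsa
    obtain ⟨ν, hν⟩ := hτ.exists_isDistribution hya
    obtain ⟨ρ, hρ⟩ := hτ.exists_isDistribution (hsa.add hya)
    refine ⟨μ, ν, ρ, hμ, hν, hρ, hμ.2.1, hν.2.1, hρ.2.1, fun n hn => ?_⟩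
    apply Complex.ofReal_injective
    rw [Complex.ofReal_add, hμ.measureCumulant_eq n hn, hν.measureCumulant_eq n hn,
      hρ.measureCumulant_eq n hn, hadd n hn]
  · intro hx
    have hne : freeCumulant τ ![s, Complex.I • ⁅s, x⁆, Complex.I • ⁅s, x⁆, s] ≠ 0 := by
      rw [hmixed, hκ2]
      have : (σ : ℂ) ≠ 0 := Complex.ofReal_ne_zero.mpr hσ.ne'
      exact mul_ne_zero (pow_ne_zero _ (pow_ne_zero _ this)) hx
    refine ⟨hne, fun hsy => hne ?_⟩
    -- for free `s` and `y`, `τ(s y y s) = τ(s²) τ(y²)`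
    have hss := Algebra.self_mem_adjoin_singleton ℂ s
    have hyy := Algebra.self_mem_adjoin_singleton ℂ (Complex.I • ⁅s, x⁆)
    rw [hκ4, htr _ s, mul_assoc s, ← mul_assoc s,
      hsy.map_mul h1 (mul_mem hss hss) (mul_mem hyy hyy), sub_self]
  · intro hx hne h
    exact hne _ (hτ.eq_algebraMap_of_freeCumulant₁_two hx h)
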